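/- Let $G_1=(V_1,E_1),\dots,G_d=(V_d,E_d)$ be finite simple connected graphs, each with a total order on its vertex set, and let $\mathscr G=G_1\times\dots\times G_d$, with vertex set $\mathscr G_0=V_1\times\dots\times V_d$ ordered componentwise. For $\mathbf u\le\mathbf v$ in $\mathscr G_0$ let $I(\mathbf u,\mathbf v)=\{i : u_i<v_i\}$. A $k$-simplex of $\mathscr G$ is a sequence $\mathbf v_0\le\dots\le\mathbf v_k$ in $\mathscr G_0$ such that $\{v_{j,i},v_{j+1,i}\}\in E_i$ for all $0\le j<k$ and all $i\in I(\mathbf v_j,\mathbf v_{j+1})$, and such that the sets $I(\mathbf v_j,\mathbf v_{j+1})$ are pairwise disjoint; it is non-degenerate if $\mathbf v_0<\dots<\mathbf v_k$. The Chow ring $\mathrm{Chow}(\mathscr G)$ is the graded quotient of $\mathbb Z[C_{\mathbf v}\mid\mathbf v\in\mathscr G_0]$ (all variables of degree one) by the ideal generated by - $C_{\mathbf v_1}\cdots C_{\mathbf v_k}$, for $k\ge1$ and $\mathbf v_1,\dots,\mathbf v_k$ that do not, in any order, form a simplex; - $C_{\mathbf u}\sum_{\mathbf v\in\mathscr G_0}C_{\mathbf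 v}$, for $\mathbf u\in\mathscr G_0$; - $C_{\mathbf u}C_{\mathbf w}\sum_{\mathbf v:\,v_i=u_i}C_{\mathbf v}$, for $\mathbf u,\mathbf w\in\mathscr G_0$ and an index $i$ with $u_i\ne w_i$. Write $\mathrm{Chow}^k$ for its piece of degree $k$, and $C_\sigma=\prod_{j}C_{\mathbf v_j}$ for a simplex $\sigma=(\mathbf v_0,\dots,\mathbf v_k)$. Let $\square^d$ be the $d$-fold product of the complete graph on $0<1$. Let $\mathscr E=E_1\times\dots\times E_d$ be the set of $d$-cubes of $\mathscr G$. For $\mathbf e\in\mathscr E$, identify the vertices of the cube $\mathbf e$ with those of $\square^d$ (in each factor the smaller endpoint of the edge is $0$ and the larger is $1$), and let $\iota_{\mathbf e}^*:\mathrm{Chow}(\mathscr G)\to\mathrm{Chow}(\square^d)$ be the ring homomorphism that sends $C_{\mathbf v}$ to the corresponding generator if $\mathbf v$ is a vertex of the cube $\mathbf e$, and to $0$ otherwise. 1. For any two non-degenerate $d$-simplices $\sigma_1,\sigma_2$ of $\square^d$ we have $C_{\sigma_1}=C_{\sigma_2}$ in $\mathrm{Chow}(\square^d)$. There is exactly one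 isomorphism of groups $\deg:\mathrm{Chow}^{d+1}(\square^d)\to\mathbb Z$ with $\deg(C_\sigma)=1$ for every non-degenerate $d$-simplex $\sigma$. 2. For all $\mathscr G$ as above, the map $\mathrm{Chow}^{d+1}(\mathscr G)\to\mathbb Z^{\mathscr E}$, $x\mapsto(\deg(\iota_{\mathbf e}^*x))_{\mathbf e\in\mathscr E}$, is an isomorphism of groups. In particular $\mathrm{Chow}^{d+1}(\mathscr G)\simeq\mathbb Z^{|\mathscr E|}$ is free of rank $|\mathscr E|=\prod_i|E_i|$. The resulting degree map $\deg:\mathrm{Chow}^{d+1}(\mathscr G)\to\mathbb Z$, $\deg(x)=\sum_{\mathbf e\in\mathscr E}\deg(\iota_{\mathbf e}^*x)$, takes the value $1$ on $C_\sigma$ for every non-degenerate $d$-simplex $\sigma$ of $\mathscr G$. -/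

import Mathlib

namespace GraphProduct

universe u

section Simplices

variable {d : ℕ} {V : Fin d → Type u} [∀ i, LinearOrder (V i)]

/-- The set `I(u, v)` of all indices `i` with `u i < v i`. -/
def moved (u v : ∀ i, V i) : Set (Fin d) := {i | u i < v i}

/-- The pair `u ≤ v` is a (possibly degenerate) 1-simplex of the product of the graphs `G i`:
whenever `u i < v i`, the pair `{u i, v i}` is an edge of `G i`. -/
def IsOneSimplex (G : ∀ i, SimpleGraph (V i)) (u v : ∀ i, V i) : Prop :=
  u ≤ v ∧ ∀ i, u i < v i → (G i).Adj (u i) (v i)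

/-- The sequence `σ 0, …, σ k` of vertices is a (possibly degenerate) `k`-simplex. -/
structure IsSimplex (G : ∀ i, SimpleGraph (V i)) {k : ℕ} (σ : Fin (k + 1) → ∀ i, V i) :
    Prop where
  step : ∀ j : Fin k, IsOneSimplex G (σ j.castSucc) (σ j.succ)
  disjoint : Pairwise fun j l : Fin k =>
    Disjoint (moved (σ j.castSucc) (σ j.succ)) (moved (σ l.castSucc) (σ l.succ))

/-- The vertices `v 0, …, v k` (in any order, possibly with repetitions) form a simplex. -/
def FormSimplex (G : ∀ i, SimpleGraph (V i)) {k : ℕ} (v : Fin (k + 1) → ∀ i, V i) : Prop :=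
  ∃ π : Equiv.Perm (Fin (k + 1)), IsSimplex G (v ∘ π)

/-- The non-degenerate `k`-simplices `σ 0 < σ 1 < … < σ k`. -/
def NDSimplex (G : ∀ i, SimpleGraph (V i)) (k : ℕ) : Type u :=
  {σ : Fin (k + 1) → ∀ i, V i // IsSimplex G σ ∧ StrictMono σ}

end Simplices

noncomputable section Chow

open MvPolynomial

variable {d : ℕ} {V : Fin d → Type u} [∀ i, LinearOrder (V i)] [∀ i, Fintype (V i)]

/-- First type of generators: products of vertices that do not form a simplex. -/
def relSimplex (G : ∀ i, SimpleGraph (V i)) : Set (MvPolynomial (∀ i, V i) ℤ) :=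
  {p | ∃ (k : ℕ) (v : Fin (k + 1) → ∀ i, V i), ¬ FormSimplex G v ∧ p = ∏ j, X (v j)}

/-- Second type of generators: `C_u * ∑ v, C_v`. -/
def relTotal (V : Fin d → Type u) [∀ i, Fintype (V i)] : Set (MvPolynomial (∀ i, V i) ℤ) :=
  {p | ∃ u : ∀ i, V i, p = X u * ∑ v : (∀ i, V i), X v}

/-- Third type of generators: `C_u * C_w * ∑ v with v i = u i, C_v`, where `u i ≠ w i`. -/
def relSlice (V : Fin d → Type u) [∀ i, LinearOrder (V i)] [∀ i, Fintype (V i)] :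
    Set (MvPolynomial (∀ i, V i) ℤ) :=
  {p | ∃ (u w : ∀ i, V i) (i : Fin d), u i ≠ w i ∧
    p = X u * X w * ∑ v : (∀ i, V i) with v i = u i, X v}

/-- The ideal of elements rationally equivalent to zero. -/
def ratIdeal (G : ∀ i, SimpleGraph (V i)) : Ideal (MvPolynomial (∀ i, V i) ℤ) :=
  Ideal.span (relSimplex G ∪ relTotal V ∪ relSlice V)

/-- The combinatorial Chow ring of the product of the graphs `G i`. -/
abbrev Chow (G : ∀ i, SimpleGraph (V i)) : Type u :=
  MvPolynomial (∀ i, V i) ℤ ⧸ ratIdeal G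

/-- The graded piece of degree `k` of the Chow ring: the classes of the homogeneous polynomials
of degree `k`. -/
def chowPiece (G : ∀ i, SimpleGraph (V i)) (k : ℕ) : Submodule ℤ (Chow G) :=
  (homogeneousSubmodule (∀ i, V i) ℤ k).map (Ideal.Quotient.mkₐ ℤ (ratIdeal G)).toLinearMap

/-- The class `C_σ` of the monomial of a non-degenerate `k`-simplex `σ`. -/
def simplexClass (G : ∀ i, SimpleGraph (V i)) {k : ℕ} (σ : NDSimplex G k) :
    chowPiece G (k + 1) :=
  ⟨Ideal.Quotient.mk (ratIdeal G) (∏ j, X (σ.1 j)), ∏ j, X (σ.1 j), by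
    simpa using IsHomogeneous.prod (Finset.univ : Finset (Fin (k + 1)))
      (fun j => (X (σ.1 j) : MvPolynomial (∀ i, V i) ℤ)) (fun _ => 1)
      (fun j _ => isHomogeneous_X ℤ (σ.1 j)), rfl⟩

/-- The `d`-dimensional hypercube: the product of `d` copies of the complete graph on the two
vertices `0 < 1`. -/
abbrev hypercube (d : ℕ) : ∀ _ : Fin d, SimpleGraph (Fin 2) := fun _ => ⊤

/-- The `d`-cubes of the product of the graphs `G i`: families consisting of an edge of each
`G i`. -/
abbrev Cube (G : ∀ i, SimpleGraph (V i)) : Type u := ∀ i, (G i).edgeSet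

/-- The inclusion of the vertices of the hypercube as the vertices of the cube `e`; in each
coordinate `0` is sent to the smaller and `1` to the larger endpoint of the edge. -/
def cubeVertex {G : ∀ i, SimpleGraph (V i)} (e : Cube G) (z : Fin d → Fin 2) : ∀ i, V i :=
  fun i => if z i = 0 then (e i).1.inf else (e i).1.sup

/-- The restriction of polynomials to the cube `e`: a variable of a vertex of the cube is sent to
the variable of the corresponding vertex of the hypercube, all other variables are sent to `0`. -/
def polyRestrict {G : ∀ i, SimpleGraph (V i)} (e : Cube G) :
    MvPolynomial (∀ i, V i) ℤ →ₐ[ℤ] MvPolynomial (Fin d → Fin 2) ℤ :=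
  aeval fun v => ∑ z : Fin d → Fin 2 with cubeVertex e z = v, X z


section Restriction

set_option linter.unusedSectionVars false

variable {G : ∀ i, SimpleGraph (V i)} (e : Cube G)

theorem edge_lt (i : Fin d) : (e i).1.inf < (e i).1.sup ∧ (G i).Adj (e i).1.inf (e i).1.sup := by
  obtain ⟨s, hs⟩ := e i
  induction s with
  | _ a b =>
    have hab : (G i).Adj a b := hs
    rcases lt_or_gt_of_ne hab.ne with h | h
    · simp only [Sym2.inf_mk, Sym2.sup_mk, inf_eq_left.2 h.le, sup_eq_right.2 h.le]
      exact ⟨h, hab⟩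
    · simp only [Sym2.inf_mk, Sym2.sup_mk, inf_eq_right.2 h.le, sup_eq_left.2 h.le]
      exact ⟨h, hab.symm⟩

theorem cubeVertex_lt_iff (z w : Fin d → Fin 2) (i : Fin d) :
    cubeVertex e z i < cubeVertex e w i ↔ z i < w i := by
  have h := (edge_lt e i).1
  have hz : z i = 0 ∨ z i = 1 := by omega
  have hw : w i = 0 ∨ w i = 1 := by omega
  rcases hz with hz | hz <;> rcases hw with hw | hw <;> simp [cubeVertex, hz, hw, h, h.le]

theorem cubeVertex_eq_iff (z w : Fin d → Fin 2) (i : Fin d) :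
    cubeVertex e z i = cubeVertex e w i ↔ z i = w i := by
  rw [← not_iff_not]
  simp only [← ne_eq, ne_iff_lt_or_gt, cubeVertex_lt_iff]

theorem cubeVertex_injective : Function.Injective (cubeVertex e) := fun z w h =>
  funext fun i => (cubeVertex_eq_iff e z w i).1 (congrFun h i)

theorem cubeVertex_adj {z w : Fin d → Fin 2} {i : Fin d} (h : z i < w i) :
    (G i).Adj (cubeVertex e z i) (cubeVertex e w i) := by
  have hz : z i = 0 := by omega
  have hw : w i = 1 := by omega
  simpa [cubeVertex, hz, hw] using (edge_lt e i).2

theorem formSimplex_cubeVertex {k : ℕ} (z : Fin (k + 1) → Fin d → Fin 2) :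
    FormSimplex G (fun j => cubeVertex e (z j)) ↔ FormSimplex (hypercube d) z := by
  have hm (a b : Fin d → Fin 2) : moved (cubeVertex e a) (cubeVertex e b) = moved a b :=
    Set.ext fun i => cubeVertex_lt_iff e a b i
  have hle (a b : Fin d → Fin 2) : cubeVertex e a ≤ cubeVertex e b ↔ a ≤ b :=
    forall_congr' fun i => by rw [← not_lt, ← not_lt, cubeVertex_lt_iff]
  refine exists_congr fun π => ⟨fun h => ⟨fun j => ?_, ?_⟩, fun h => ⟨fun j => ?_, ?_⟩⟩
  · exact ⟨(hle _ _).1 (h.step j).1, fun i hi => hi.ne⟩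
  · intro j l hjl
    simpa only [Function.comp_apply, hm] using h.disjoint hjl
  · exact ⟨(hle _ _).2 (h.step j).1, fun i hi =>
      cubeVertex_adj e ((cubeVertex_lt_iff e _ _ i).1 hi)⟩
  · intro j l hjl
    simpa only [Function.comp_apply, hm] using h.disjoint hjl

theorem polyRestrict_X_cubeVertex (z : Fin d → Fin 2) :
    polyRestrict e (X (cubeVertex e z)) = X z := by
  simp [polyRestrict, (cubeVertex_injective e).eq_iff, Finset.filter_eq']

theorem polyRestrict_X_of_forall_ne {v : ∀ i, V i} (h : ∀ z, cubeVertex e z ≠ v) :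
    polyRestrict e (X v) = 0 := by
  simp [polyRestrict, h]

theorem polyRestrict_sum (p : (∀ i, V i) → Prop) [DecidablePred p] :
    polyRestrict e (∑ v : (∀ i, V i) with p v, X v) =
      ∑ z : Fin d → Fin 2 with p (cubeVertex e z), X z := by
  rw [map_sum]
  symm
  refine Finset.sum_of_injOn (cubeVertex e) (cubeVertex_injective e).injOn ?_ ?_ ?_
  · intro z hz
    simpa using hz
  · intro v hv hv'
    refine polyRestrict_X_of_forall_ne e fun z hz => hv' ⟨z, ?_, hz⟩
    subst hz
    simpa using hv
  · intro z _
    exact (polyRestrict_X_cubeVertex e z).symm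

theorem ratIdeal_le_comap :
    ratIdeal G ≤ (ratIdeal (hypercube d)).comap (polyRestrict e).toRingHom := by
  refine Ideal.span_le.2 ?_
  rintro p ((⟨k, v, hv, rfl⟩ | ⟨u, rfl⟩) | ⟨u, w, i, hi, rfl⟩)
  · change polyRestrict e _ ∈ ratIdeal (hypercube d)
    rw [map_prod]
    by_cases h : ∀ j, ∃ z, cubeVertex e z = v j
    · choose z hz using h
      obtain rfl : (fun j => cubeVertex e (z j)) = v := funext hz
      simp only [polyRestrict_X_cubeVertex]
      exact Ideal.subset_span (Or.inl (Or.inl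
        ⟨k, z, fun h => hv ((formSimplex_cubeVertex e z).2 h), rfl⟩))
    · push Not at h
      obtain ⟨j, hj⟩ := h
      rw [Finset.prod_eq_zero (Finset.mem_univ j) (polyRestrict_X_of_forall_ne e hj)]
      exact zero_mem _
  · change polyRestrict e _ ∈ ratIdeal (hypercube d)
    by_cases h : ∃ z, cubeVertex e z = u
    · obtain ⟨z, rfl⟩ := h
      have := polyRestrict_sum e (fun _ => True)
      simp only [Finset.filter_true] at this
      rw [map_mul, polyRestrict_X_cubeVertex, this]
      exact Ideal.subset_span (Or.inl (Or.inr ⟨z, rfl⟩))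
    · push Not at h
      rw [map_mul, polyRestrict_X_of_forall_ne e h, zero_mul]
      exact zero_mem _
  · change polyRestrict e _ ∈ ratIdeal (hypercube d)
    by_cases h : ∃ z, cubeVertex e z = u
    · obtain ⟨z, rfl⟩ := h
      by_cases h' : ∃ y, cubeVertex e y = w
      · obtain ⟨y, rfl⟩ := h'
        rw [map_mul, map_mul, polyRestrict_X_cubeVertex, polyRestrict_X_cubeVertex,
          polyRestrict_sum]
        simp only [cubeVertex_eq_iff]
        exact Ideal.subset_span (Or.inr
          ⟨z, y, i, fun h => hi ((cubeVertex_eq_iff e z y i).2 h), rfl⟩)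
      · push Not at h'
        rw [map_mul, map_mul, polyRestrict_X_of_forall_ne e h', mul_zero, zero_mul]
        exact zero_mem _
    · push Not at h
      rw [map_mul, map_mul, polyRestrict_X_of_forall_ne e h, zero_mul, zero_mul]
      exact zero_mem _

/-- The restriction map `ι_e^*` from the Chow ring of the product of the graphs to the Chow ring
of the cube `e`, identified with the hypercube. -/
def chowRestrict : Chow G →+* Chow (hypercube d) :=
  Ideal.quotientMap (ratIdeal (hypercube d)) (polyRestrict e).toRingHom (ratIdeal_le_comap e)

theorem chowRestrict_mem {k : ℕ} {x : Chow G} (hx : x ∈ chowPiece G k) :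
    chowRestrict e x ∈ chowPiece (hypercube d) k := by
  obtain ⟨p, hp, rfl⟩ := hx
  refine ⟨polyRestrict e p, ?_, rfl⟩
  have h := IsHomogeneous.aeval (n := 1) (m := k) hp
    (fun v => ∑ z : Fin d → Fin 2 with cubeVertex e z = v, (X z : MvPolynomial _ ℤ))
    (fun v => IsHomogeneous.sum _ _ _ fun z _ => isHomogeneous_X ℤ z)
  rw [one_mul] at h
  exact h

/-- The restriction map `ι_e^*` in degree `k`. -/
def pieceRestrict (k : ℕ) : chowPiece G k →ₗ[ℤ] chowPiece (hypercube d) k :=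
  (chowRestrict e).toAddMonoidHom.toIntLinearMap.restrict fun _ hx => chowRestrict_mem e hx

end Restriction

end Chow

end GraphProduct

/-! The top degree is bounded from both sides.

Spanning. $\mathrm{Chow}^{d+1}(\mathscr G)$ is generated by one class per cube. A product of $d+1$
vertices with a repetition is rewritten, by the total and slice relations (`exists_relation`), into
products with more distinct vertices (`mk_prod_mem_span`). A product of $d+1$ distinct vertices is
either zero or a maximal simplex, and such a simplex is a cube together with an order of its
directions (`exists_flagSimplex_eq`). Two slice relations with a common remainder swap consecutive
directions, so the class depends on the cube alone (`simplexClass_flagSimplex_eq`).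

Independence. Restriction to a cube kills the classes of all other cubes, so it suffices to find a
functional on the Chow ring of the hypercube that is 1 on maximal simplices. It is given by a
formula. For a chain $w_1<\dots<w_r$ with multiplicities $m_j$, put
$b_j=m_1+\dots+m_j-\mathrm{rank}\,w_j-1$ and $g_j=\mathrm{rank}\,w_{j+1}-\mathrm{rank}\,w_j$. In
total degree $d+1$ the value is
$(-1)^{\sum(m_j-1)}\binom{m_1-1}{\mathrm{rank}\,w_1}\prod_j\binom{g_j-1}{b_j}\binom{m_{j+1}-1}{g_j-1-b_j}$,
and in other degrees it is 0. The truncated subtractions do no harm: whenever one of them is not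
genuine, a binomial factor vanishes. The functional kills the ideal because the sum over one added
vertex collapses along the chain by Pascal's rule (`tailDegree_sum`, `tailDegree_sum_apply_eq_one`,
`chainDegree_sum`). -/

namespace GraphProduct

open Finset
open scoped Classical

/-! ### Ranks and intervals in the hypercube. -/

section Hypercube

variable {d : ℕ}

/-- The number of coordinates of a vertex of the hypercube that are equal to `1`. -/
def rank (v : Fin d → Fin 2) : ℕ := ∑ i, (v i : ℕ)

theorem rank_eq_add_card {p v : Fin d → Fin 2} (h : p ≤ v) :
    rank v = rank p + #{i | p i < v i} := by
  rw [rank, rank, card_filter, ← sum_add_distrib]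
  refine sum_congr rfl fun i _ => ?_
  have : p i ≤ v i := h i
  split_ifs <;> omega

theorem rank_strictMono : StrictMono (rank (d := d)) := by
  intro p v h
  obtain ⟨hle, i, hi⟩ := Pi.lt_def.1 h
  have : 0 < #{i | p i < v i} := card_pos.2 ⟨i, by simpa using hi⟩
  rw [rank_eq_add_card hle]
  omega

theorem rank_le (v : Fin d → Fin 2) : rank v ≤ d := by
  calc rank v ≤ ∑ _i : Fin d, 1 := sum_le_sum fun i _ => by omega
    _ = d := by simp

theorem rank_one : rank (1 : Fin d → Fin 2) = d := by simp [rank]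

theorem rank_zero : rank (0 : Fin d → Fin 2) = 0 := by simp [rank]

theorem vertex_le_one (v : Fin d → Fin 2) : v ≤ 1 := fun i => by
  change v i ≤ 1
  omega

theorem eq_one_of_rank_eq {v : Fin d → Fin 2} (h : rank v = d) : v = 1 := by
  refine eq_of_le_of_not_lt (vertex_le_one v) fun hlt => ?_
  have := rank_strictMono hlt
  rw [rank_one] at this
  omega

theorem eq_zero_of_rank_eq {v : Fin d → Fin 2} (h : rank v = 0) : v = 0 := by
  by_contra hne
  have := rank_strictMono (lt_of_le_of_ne (fun i => Fin.zero_le _ : (0 : Fin d → Fin 2) ≤ v)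
    (Ne.symm hne))
  omega

/-- A vertex of the interval is determined by the set of coordinates raised above `p`, an arbitrary
subset of those in which `p` and `w` differ. -/
theorem card_interval_rank {p w : Fin d → Fin 2} (h : p ≤ w) (s : ℕ) :
    #{v | (p ≤ v ∧ v ≤ w) ∧ rank v = rank p + s} = (rank w - rank p).choose s := by
  have hc : rank w - rank p = #{i | p i < w i} := by
    rw [rank_eq_add_card h]; omega
  rw [hc, ← card_powersetCard]
  refine card_nbij' (fun v => ({i | p i < v i} : Finset (Fin d)))
    (fun t i => if i ∈ t then 1 else p i) ?_ ?_ ?_ ?_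
  · intro v hv
    simp only [mem_coe, mem_filter, mem_univ, true_and] at hv
    simp only [mem_coe, mem_powersetCard]
    constructor
    · intro i hi
      simp only [mem_filter, mem_univ, true_and] at hi ⊢
      exact hi.trans_le (hv.1.2 i)
    · have := rank_eq_add_card hv.1.1
      omega
  · intro t ht
    simp only [mem_coe, mem_powersetCard] at ht
    have hlt (i) (hi : i ∈ t) : p i < w i := by simpa using ht.1 hi
    have hle : p ≤ fun i => if i ∈ t then (1 : Fin 2) else p i := by
      intro i
      dsimp only
      split_ifs <;> omega
    simp only [mem_coe, mem_filter, mem_univ, true_and]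
    refine ⟨⟨hle, fun i => ?_⟩, ?_⟩
    · dsimp only
      split_ifs with hi
      · have := hlt i hi
        omega
      · exact h i
    · rw [rank_eq_add_card hle, ← ht.2]
      congr 2
      ext i
      simp only [mem_filter, mem_univ, true_and]
      constructor
      · intro hi
        by_contra hit
        simp [hit] at hi
      · intro hi
        have := hlt i hi
        simp only [hi, if_true]
        omega
  · intro v hv
    simp only [mem_coe, mem_filter, mem_univ, true_and] at hv
    funext i
    have : p i ≤ v i := hv.1.1 i
    simp only [mem_filter, mem_univ, true_and]
    split_ifs <;> omega
  · intro t ht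
    simp only [mem_coe, mem_powersetCard] at ht
    have hlt (i) (hi : i ∈ t) : p i < w i := by simpa using ht.1 hi
    ext i
    simp only [mem_filter, mem_univ, true_and]
    constructor
    · intro hi
      by_contra hit
      simp [hit] at hi
    · intro hi
      have := hlt i hi
      simp only [hi, if_true]
      omega

theorem card_between_rank {p w : Fin d → Fin 2} (h : p < w) {b : ℕ}
    (hb : b + 1 < rank w - rank p) :
    #{v | (p < v ∧ v < w) ∧ rank v = rank p + (b + 1)} = (rank w - rank p).choose (b + 1) := by
  rw [← card_interval_rank h.le]
  congr 1
  ext v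
  simp only [mem_filter, mem_univ, true_and]
  constructor
  · rintro ⟨⟨h1, h2⟩, h3⟩
    exact ⟨⟨h1.le, h2.le⟩, h3⟩
  · rintro ⟨⟨h1, h2⟩, h3⟩
    refine ⟨⟨lt_of_le_of_ne h1 ?_, lt_of_le_of_ne h2 ?_⟩, h3⟩ <;> rintro rfl <;> omega

theorem card_between_rank_apply_eq_one {p w : Fin d → Fin 2} (h : p < w) {i : Fin d}
    (hp : p i = 0) (hw : w i = 1) {b : ℕ} (hb : b + 1 < rank w - rank p) :
    #{v | v i = 1 ∧ (p < v ∧ v < w) ∧ rank v = rank p + (b + 1)} =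
      (rank w - rank p - 1).choose b := by
  -- Raising coordinate `i` of `p` turns the condition `v i = 1` into `q ≤ v`, at the cost of one
  -- unit of rank.
  set q : Fin d → Fin 2 := Function.update p i 1 with hq
  have hpq : p ≤ q := by
    intro j
    rcases eq_or_ne j i with rfl | hj
    · simp [hp]
    · simp [hq, hj]
  have hqw : q ≤ w := by
    intro j
    rcases eq_or_ne j i with rfl | hj
    · simp [hq, hw]
    · simpa [hq, hj] using h.le j
  have hr : rank q = rank p + 1 := by
    rw [rank_eq_add_card hpq, add_right_inj, card_eq_one]
    refine ⟨i, ?_⟩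
    ext j
    simp only [mem_filter, mem_univ, true_and, mem_singleton]
    rcases eq_or_ne j i with rfl | hj
    · simp [hq, hp]
    · simp [hq, hj]
  have hs : rank w - rank p - 1 = rank w - rank q := by omega
  rw [hs, ← card_interval_rank hqw]
  congr 1
  ext v
  simp only [mem_filter, mem_univ, true_and]
  constructor
  · rintro ⟨h0, ⟨h1, h2⟩, h3⟩
    refine ⟨⟨fun j => ?_, h2.le⟩, by omega⟩
    rcases eq_or_ne j i with rfl | hj
    · simp [hq, h0]
    · simpa [hq, hj] using h1.le j
  · rintro ⟨⟨h1, h2⟩, h3⟩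
    refine ⟨?_, ⟨lt_of_le_of_ne (hpq.trans h1) ?_, lt_of_le_of_ne h2 ?_⟩, by omega⟩
    · have : q i ≤ v i := h1 i
      simp only [hq, Function.update_self] at this
      omega
    · rintro rfl; omega
    · rintro rfl; omega

/-! ### The degree formula on chains. -/

/-- The contribution to the degree of a monomial with multiplicities `m` of the chain `l` of
vertices above the vertex `p`. The number `b` is the sum of the multiplicities of all vertices of
the chain up to `p`, minus `rank p + 1`. -/
noncomputable def tailDegree (m : (Fin d → Fin 2) →₀ ℕ) : (Fin d → Fin 2) → ℕ → List (Fin d → Fin 2) → ℤ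
  | p, b, [] => if b + rank p = d then 1 else 0
  | p, b, w :: l => if p < w then
      (-1) ^ (m w - 1) * (rank w - rank p - 1).choose b *
        (m w - 1).choose (rank w - rank p - 1 - b) *
        tailDegree m w (m w + b - (rank w - rank p)) l
      else 0

/-- The degree of the monomial with multiplicities `m` supported on the chain `l`. -/
noncomputable def chainDegree (m : (Fin d → Fin 2) →₀ ℕ) : List (Fin d → Fin 2) → ℤ
  | [] => 0
  | w :: l => (-1) ^ (m w - 1) * (m w - 1).choose (rank w) *
      tailDegree m w (m w - 1 - rank w) l

/-- Insertion of a vertex into a chain. -/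
noncomputable def chainInsert (v : Fin d → Fin 2) : List (Fin d → Fin 2) → List (Fin d → Fin 2)
  | [] => [v]
  | w :: l => if v = w then w :: l else if v < w then v :: w :: l else w :: chainInsert v l

theorem mem_chainInsert {v x : Fin d → Fin 2} {l : List (Fin d → Fin 2)} :
    x ∈ chainInsert v l ↔ x = v ∨ x ∈ l := by
  induction l with
  | nil => simp [chainInsert]
  | cons w l ih =>
    rw [chainInsert]
    split_ifs with h1 h2
    · subst h1; simp
    · simp
    · simp only [List.mem_cons, ih]; tauto

theorem pairwise_chainInsert {v : Fin d → Fin 2} {l : List (Fin d → Fin 2)}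
    (hl : l.Pairwise (· < ·)) (hv : ∀ x ∈ l, x ≤ v ∨ v ≤ x) :
    (chainInsert v l).Pairwise (· < ·) := by
  induction l with
  | nil => simp [chainInsert]
  | cons w l ih =>
    rw [List.pairwise_cons] at hl
    rw [chainInsert]
    split_ifs with h1 h2
    · exact List.pairwise_cons.2 hl
    · refine List.pairwise_cons.2 ⟨?_, List.pairwise_cons.2 hl⟩
      intro x hx
      rcases List.mem_cons.1 hx with rfl | hx
      · exact h2
      · exact h2.trans (hl.1 x hx)
    · refine List.pairwise_cons.2 ⟨?_, ih hl.2 fun x hx => hv x (List.mem_cons_of_mem _ hx)⟩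
      intro x hx
      rcases mem_chainInsert.1 hx with rfl | hx
      · rcases hv w List.mem_cons_self with h | h
        · exact lt_of_le_of_ne h (Ne.symm h1)
        · exact absurd (lt_of_le_of_ne h h1) h2
      · exact hl.1 x hx

theorem tailDegree_congr {m m' : (Fin d → Fin 2) →₀ ℕ} {l : List (Fin d → Fin 2)}
    (h : ∀ x ∈ l, m x = m' x) (p : Fin d → Fin 2) (b : ℕ) :
    tailDegree m p b l = tailDegree m' p b l := by
  induction l generalizing p b with
  | nil => rfl
  | cons w l ih =>
    rw [tailDegree, tailDegree, h w List.mem_cons_self,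
      ih fun x hx => h x (List.mem_cons_of_mem _ hx)]

/-- The recursion tests every consecutive pair. Inserting a vertex incomparable to the chain thus
contributes 0, and sums may run over all vertices. -/
theorem tailDegree_eq_zero {m : (Fin d → Fin 2) →₀ ℕ} {p : Fin d → Fin 2}
    {l : List (Fin d → Fin 2)} (b : ℕ) (h : ¬ (p :: l).Pairwise (· < ·)) :
    tailDegree m p b l = 0 := by
  induction l generalizing p b with
  | nil => simp at h
  | cons w l ih =>
    rw [tailDegree]
    split_ifs with hp
    · rw [ih, mul_zero]
      intro hl
      refine h (List.pairwise_cons.2 ⟨?_, hl⟩)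
      intro x hx
      rcases List.mem_cons.1 hx with rfl | hx
      · exact hp
      · exact hp.trans ((List.pairwise_cons.1 hl).1 x hx)
    · rfl

theorem chainDegree_eq_zero {m : (Fin d → Fin 2) →₀ ℕ} {l : List (Fin d → Fin 2)}
    (h : ¬ l.Pairwise (· < ·)) : chainDegree m l = 0 := by
  cases l with
  | nil => rfl
  | cons w l => rw [chainDegree, tailDegree_eq_zero _ h, mul_zero]

end Hypercube

/-! ### Summing the formula over an added vertex. -/

section HypercubeSums

variable {d : ℕ}

theorem tailDegree_chainInsert_eq_zero {m : (Fin d → Fin 2) →₀ ℕ} {v w : Fin d → Fin 2}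
    {l : List (Fin d → Fin 2)} (b : ℕ) (h : ¬ w < v) :
    tailDegree m w b (chainInsert v l) = 0 :=
  tailDegree_eq_zero b fun hp =>
    h ((List.pairwise_cons.1 hp).1 v (mem_chainInsert.2 (Or.inl rfl)))

/-- One binomial needs a rank gap of at least `b + 1`; the other, with upper entry 0, needs a gap of
at most `b + 1`. -/
theorem tailDegree_insert_singleton {m : (Fin d → Fin 2) →₀ ℕ} {p v : Fin d → Fin 2}
    {l : List (Fin d → Fin 2)} (b : ℕ) (hpv : p < v) (hm : m v = 1) :
    tailDegree m p b (v :: l) =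
      if rank v = rank p + (b + 1) then tailDegree m v 0 l else 0 := by
  have hr := rank_strictMono hpv
  rw [tailDegree, if_pos hpv, hm]
  split_ifs with h
  · have h1 : rank v - rank p - 1 = b := by omega
    have h2 : 1 + b - (rank v - rank p) = 0 := by omega
    simp [h1, h2]
  · rcases lt_or_gt_of_ne h with h | h
    · rw [Nat.choose_eq_zero_of_lt (n := rank v - rank p - 1) (by omega)]
      simp
    · rw [Nat.choose_eq_zero_of_lt (n := 1 - 1) (by omega)]
      simp

/-- The three summands are the possible positions of `v`: strictly between `p` and `w`, at `w`, or
beyond `w`. -/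
theorem tailDegree_insert_cons {m : (Fin d → Fin 2) →₀ ℕ} {p w : Fin d → Fin 2}
    {l : List (Fin d → Fin 2)} (hpw : p < w) (hl : (w :: l).Pairwise (· < ·))
    (hm : ∀ x, p < x → (x ∈ w :: l ↔ m x ≠ 0)) (b : ℕ) (v : Fin d → Fin 2) :
    tailDegree (m + Finsupp.single v 1) p b (chainInsert v (w :: l)) =
      (if (p < v ∧ v < w) ∧ rank v = rank p + (b + 1) then
        (-1) ^ (m w - 1) * ((m w - 1).choose (rank w - rank p - 1 - (b + 1)) : ℤ) *
          tailDegree m w (m w + (b + 1) - (rank w - rank p)) l else 0) +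
      (if v = w then
        (-1) ^ (m w) * ((rank w - rank p - 1).choose b : ℤ) *
          (m w).choose (rank w - rank p - 1 - b) *
          tailDegree m w (m w + (b + 1) - (rank w - rank p)) l else 0) +
      (-1) ^ (m w - 1) * ((rank w - rank p - 1).choose b : ℤ) *
        (m w - 1).choose (rank w - rank p - 1 - b) *
        tailDegree (m + Finsupp.single v 1) w (m w + b - (rank w - rank p)) (chainInsert v l) := by
  have hl' := (List.pairwise_cons.1 hl).1
  rw [chainInsert]
  split_ifs with h1 h2 h3 h4 h5
  · exact absurd (h1 ▸ h2.1.2) (lt_irrefl _)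
  · subst h1
    rw [tailDegree_chainInsert_eq_zero _ (lt_irrefl _), tailDegree, if_pos hpw,
      tailDegree_congr (m' := m) (fun x hx => by simp [(hl' x hx).ne'])]
    simp only [Finsupp.add_apply, Finsupp.single_eq_same, Nat.add_sub_cancel, mul_zero, add_zero,
      zero_add]
    rw [show m v + 1 + b = m v + (b + 1) by omega]
  · have hmv : m v = 0 := by
      by_contra h
      rcases List.mem_cons.1 ((hm v h4.1.1).2 h) with rfl | h
      · exact h1 rfl
      · exact lt_asymm h3 (hl' v h)
    rw [tailDegree_chainInsert_eq_zero _ h3.asymm, tailDegree_insert_singleton _ h4.1.1 (by simp [hmv]),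
      if_pos h4.2, tailDegree, if_pos h3, tailDegree_congr (m' := m)
        (fun x hx => by simp [(h3.trans (hl' x hx)).ne'])]
    have hmw : (m + Finsupp.single v 1 : (Fin d → Fin 2) →₀ ℕ) w = m w := by simp [h3.ne']
    have hr := rank_strictMono h3
    rw [hmw]
    simp only [Nat.choose_zero_right, mul_zero, add_zero, Nat.cast_one, mul_one, Nat.sub_zero]
    have hv := h4.2
    rw [show rank w - rank v - 1 = rank w - rank p - 1 - (b + 1) by omega,
      show m w - (rank w - rank v) = m w + (b + 1) - (rank w - rank p) by omega]
  · rw [tailDegree_chainInsert_eq_zero _ h3.asymm]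
    by_cases hpv : p < v
    · have hmv : m v = 0 := by
        by_contra h
        rcases List.mem_cons.1 ((hm v hpv).2 h) with rfl | h
        · exact h1 rfl
        · exact lt_asymm h3 (hl' v h)
      rw [tailDegree_insert_singleton _ hpv (by simp [hmv]), if_neg fun h => h4 ⟨⟨hpv, h3⟩, h⟩]
      simp
    · rw [tailDegree, if_neg hpv]
      simp
  · exact absurd h5.1.2 h3
  · rw [tailDegree, if_pos hpw]
    simp [Ne.symm h1]

/-- The predicate `F` is kept general to serve both the total and the slice relations. -/
theorem tailDegree_sum_cons {m : (Fin d → Fin 2) →₀ ℕ} {p w : Fin d → Fin 2}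
    {l : List (Fin d → Fin 2)} (hpw : p < w) (hl : (w :: l).Pairwise (· < ·))
    (hm : ∀ x, p < x → (x ∈ w :: l ↔ m x ≠ 0)) (b : ℕ) (F : (Fin d → Fin 2) → Prop)
    [DecidablePred F] :
    ∑ v with F v, tailDegree (m + Finsupp.single v 1) p b (chainInsert v (w :: l)) =
      (#{v | F v ∧ (p < v ∧ v < w) ∧ rank v = rank p + (b + 1)} : ℤ) *
        ((-1) ^ (m w - 1) * ((m w - 1).choose (rank w - rank p - 1 - (b + 1)) : ℤ) *
          tailDegree m w (m w + (b + 1) - (rank w - rank p)) l) +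
      (if F w then
        (-1) ^ (m w) * ((rank w - rank p - 1).choose b : ℤ) *
          (m w).choose (rank w - rank p - 1 - b) *
          tailDegree m w (m w + (b + 1) - (rank w - rank p)) l else 0) +
      (-1) ^ (m w - 1) * ((rank w - rank p - 1).choose b : ℤ) *
        (m w - 1).choose (rank w - rank p - 1 - b) *
        ∑ v with F v, tailDegree (m + Finsupp.single v 1) w (m w + b - (rank w - rank p))
          (chainInsert v l) := by
  rw [sum_congr rfl fun v _ => tailDegree_insert_cons hpw hl hm b v, sum_add_distrib,
    sum_add_distrib, ← mul_sum, ← sum_filter, sum_const, nsmul_eq_mul, filter_filter]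
  congr 2
  rw [sum_ite_eq']
  simp

/-- Adding one vertex above `p` in all possible ways. -/
theorem tailDegree_sum {m : (Fin d → Fin 2) →₀ ℕ} {p : Fin d → Fin 2}
    {l : List (Fin d → Fin 2)} (hl : (p :: l).Pairwise (· < ·))
    (hm : ∀ x, p < x → (x ∈ l ↔ m x ≠ 0)) (b : ℕ) :
    ∑ v, tailDegree (m + Finsupp.single v 1) p b (chainInsert v l) =
      tailDegree m p (b + 1) l := by
  induction l generalizing p b with
  | nil =>
    -- Beyond the end of the chain only the top vertex contributes, being the only one of rank `d`.
    have key (v : Fin d → Fin 2) :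
        tailDegree (m + Finsupp.single v 1) p b (chainInsert v []) =
          if v = 1 then (if b + 1 + rank p = d then 1 else 0) else 0 := by
      by_cases hpv : p < v
      · have hmv : m v = 0 := by simpa using hm v hpv
        rw [chainInsert, tailDegree_insert_singleton _ hpv (by simp [hmv]), tailDegree]
        rcases eq_or_ne v 1 with rfl | hv
        · simp only [rank_one, zero_add, if_true]
          congr 1
          exact propext ⟨fun h => by omega, fun h => by omega⟩
        · have : rank v ≠ d := fun h => hv (eq_one_of_rank_eq h)
          simp [hv, this]
      · rw [chainInsert, tailDegree, if_neg hpv]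
        split_ifs with h1 h2
        · subst h1
          have : p = 1 := by
            by_contra hne
            exact hpv (lt_of_le_of_ne (vertex_le_one p) hne)
          rw [this, rank_one] at h2
          omega
        · rfl
        · rfl
    simp only [key, sum_ite_eq', mem_univ, if_true, tailDegree]
  | cons w l ih =>
    obtain ⟨hpl, hl'⟩ := List.pairwise_cons.1 hl
    have hpw : p < w := hpl w List.mem_cons_self
    have hr := rank_strictMono hpw
    have hmw : m w ≠ 0 := (hm w hpw).1 List.mem_cons_self
    have hm' (x) (hx : w < x) : x ∈ l ↔ m x ≠ 0 := by
      rw [← hm x (hpw.trans hx), List.mem_cons, or_iff_right hx.ne']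
    have hs := tailDegree_sum_cons hpw hl' hm b fun _ => True
    simp only [filter_true, true_and, if_true] at hs
    rw [hs, ih hl' hm', tailDegree, if_pos hpw]
    obtain ⟨μ, hμ⟩ := Nat.exists_eq_succ_of_ne_zero hmw
    obtain ⟨n, hn⟩ : ∃ n, rank w - rank p = n + 1 := ⟨rank w - rank p - 1, by omega⟩
    have hcard : b < n → (#{v | (p < v ∧ v < w) ∧ rank v = rank p + (b + 1)} : ℤ) =
        n.choose b + n.choose (b + 1) := fun hb => by
      rw [card_between_rank hpw (by omega), hn, Nat.choose_succ_succ, Nat.cast_add]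
    rw [hn, hμ]
    simp only [Nat.succ_eq_add_one, Nat.add_sub_cancel]
    -- Up to sign and a common tail, $\left(\binom nb+\binom n{b+1}\right)\binom\mu{n-b-1}-\binom
    -- nb\binom{\mu+1}{n-b}+\binom nb\binom\mu{n-b}$ reduces by Pascal to $\binom
    -- n{b+1}\binom\mu{n-b-1}$. For `b ≥ n` there is no room strictly between `p` and `w`.
    rcases lt_trichotomy b n with hb | rfl | hb
    · rw [hcard hb]
      obtain ⟨k, rfl⟩ : ∃ k, n = b + 1 + k := ⟨n - (b + 1), by omega⟩
      rw [show b + 1 + k - b = k + 1 by omega, show b + 1 + k - (b + 1) = k by omega,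
        Nat.choose_succ_succ μ k]
      -- The tails agree when the truncated subtraction is genuine; otherwise the coefficient of the
      -- inductive term is 0.
      rcases lt_or_ge μ (k + 1) with h | h
      · rw [Nat.choose_eq_zero_of_lt h]
        push_cast
        ring
      · rw [show μ + 1 + b - (b + 1 + k + 1) + 1 = μ + 1 + (b + 1) - (b + 1 + k + 1) by omega]
        push_cast
        ring
    · have : #{v | (p < v ∧ v < w) ∧ rank v = rank p + (b + 1)} = 0 := by
        refine card_eq_zero.2 (filter_eq_empty_iff.2 fun v _ hv => ?_)
        have := rank_strictMono hv.1.2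
        omega
      rw [this, show μ + 1 + b - (b + 1) + 1 = μ + 1 + (b + 1) - (b + 1) by omega]
      simp only [Nat.choose_self, Nat.sub_self, Nat.choose_zero_right,
        Nat.choose_succ_self]
      push_cast
      ring
    · have : #{v | (p < v ∧ v < w) ∧ rank v = rank p + (b + 1)} = 0 := by
        refine card_eq_zero.2 (filter_eq_empty_iff.2 fun v _ hv => ?_)
        have := rank_strictMono hv.1.2
        omega
      rw [this, Nat.choose_eq_zero_of_lt hb, Nat.choose_eq_zero_of_lt (Nat.lt_succ_of_lt hb)]
      simp

/-- Adding one vertex in the half space `v i = 1` above a vertex `p` with `p i = 0`, when the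
chain crosses to the half space after `p`. -/
theorem tailDegree_sum_apply_eq_one {m : (Fin d → Fin 2) →₀ ℕ} {p : Fin d → Fin 2}
    {l : List (Fin d → Fin 2)} (hl : (p :: l).Pairwise (· < ·))
    (hm : ∀ x, p < x → (x ∈ l ↔ m x ≠ 0)) {i : Fin d} (hp : p i = 0) (hi : ∃ x ∈ l, x i = 1)
    (b : ℕ) :
    ∑ v with v i = 1, tailDegree (m + Finsupp.single v 1) p b (chainInsert v l) = 0 := by
  induction l generalizing p b with
  | nil => simp at hi
  | cons w l ih =>
    obtain ⟨hpl, hl'⟩ := List.pairwise_cons.1 hl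
    have hpw : p < w := hpl w List.mem_cons_self
    have hr := rank_strictMono hpw
    have hmw : m w ≠ 0 := (hm w hpw).1 List.mem_cons_self
    have hm' (x) (hx : w < x) : x ∈ l ↔ m x ≠ 0 := by
      rw [← hm x (hpw.trans hx), List.mem_cons, or_iff_right hx.ne']
    rw [tailDegree_sum_cons hpw hl' hm b fun v => v i = 1]
    rcases (show w i = 0 ∨ w i = 1 by omega) with hw | hw
    · have : #{v | v i = 1 ∧ (p < v ∧ v < w) ∧ rank v = rank p + (b + 1)} = 0 := by
        refine card_eq_zero.2 (filter_eq_empty_iff.2 fun v _ hv => ?_)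
        have : v i ≤ w i := hv.2.1.2.le i
        omega
      rw [this, ih hl' hm' hw]
      · simp [hw]
      · obtain ⟨x, hx, hx1⟩ := hi
        rcases List.mem_cons.1 hx with rfl | hx
        · omega
        · exact ⟨x, hx, hx1⟩
    -- Everything above `w` already lies in the half space, so beyond `w` the restricted sum is the
    -- full one.
    · have hs : ∑ v with v i = 1, tailDegree (m + Finsupp.single v 1) w
          (m w + b - (rank w - rank p)) (chainInsert v l) =
          tailDegree m w (m w + b - (rank w - rank p) + 1) l := by
        rw [← tailDegree_sum hl' hm']
        refine sum_subset (filter_subset _ _) fun v _ hv => ?_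
        refine tailDegree_chainInsert_eq_zero _ fun hwv => hv ?_
        have : w i ≤ v i := hwv.le i
        simp only [mem_filter, mem_univ, true_and]
        omega
      rw [hs, if_pos hw]
      obtain ⟨μ, hμ⟩ := Nat.exists_eq_succ_of_ne_zero hmw
      obtain ⟨n, hn⟩ : ∃ n, rank w - rank p = n + 1 := ⟨rank w - rank p - 1, by omega⟩
      have hcard : b < n → (#{v | v i = 1 ∧ (p < v ∧ v < w) ∧ rank v = rank p + (b + 1)} : ℤ) =
          n.choose b := fun hb => by
        rw [card_between_rank_apply_eq_one hpw hp hw (by omega), hn, Nat.add_sub_cancel]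
      rw [hn, hμ]
      simp only [Nat.succ_eq_add_one, Nat.add_sub_cancel]
      -- The count of intermediate vertices is now only $\binom nb$. The missing $\binom n{b+1}$ is
      -- exactly what survived in `tailDegree_sum`, so Pascal leaves 0.
      rcases lt_trichotomy b n with hb | rfl | hb
      · rw [hcard hb]
        obtain ⟨k, rfl⟩ : ∃ k, n = b + 1 + k := ⟨n - (b + 1), by omega⟩
        rw [show b + 1 + k - b = k + 1 by omega, show b + 1 + k - (b + 1) = k by omega,
          Nat.choose_succ_succ μ k]
        rcases lt_or_ge μ (k + 1) with h | h
        · rw [Nat.choose_eq_zero_of_lt h]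
          push_cast
          ring
        · rw [show μ + 1 + b - (b + 1 + k + 1) + 1 = μ + 1 + (b + 1) - (b + 1 + k + 1) by omega]
          push_cast
          ring
      · have : #{v | v i = 1 ∧ (p < v ∧ v < w) ∧ rank v = rank p + (b + 1)} = 0 := by
          refine card_eq_zero.2 (filter_eq_empty_iff.2 fun v _ hv => ?_)
          have := rank_strictMono hv.2.1.2
          omega
        rw [this, show μ + 1 + b - (b + 1) + 1 = μ + 1 + (b + 1) - (b + 1) by omega]
        simp only [Nat.choose_self, Nat.sub_self, Nat.choose_zero_right]
        push_cast
        ring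
      · have : #{v | v i = 1 ∧ (p < v ∧ v < w) ∧ rank v = rank p + (b + 1)} = 0 := by
          refine card_eq_zero.2 (filter_eq_empty_iff.2 fun v _ hv => ?_)
          have := rank_strictMono hv.2.1.2
          omega
        rw [this, Nat.choose_eq_zero_of_lt hb]
        simp

end HypercubeSums

open MvPolynomial

/-! ### The degree functional on the Chow ring of the hypercube. -/

section HypercubeDegree

variable {d : ℕ}

/-- A new lowest vertex has multiplicity 1 and brings the factor $\binom0{\mathrm{rank}\,v}$; hence
only the vertex 0 contributes below `w`. -/
theorem chainDegree_insert_cons {m : (Fin d → Fin 2) →₀ ℕ} {w : Fin d → Fin 2}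
    {l : List (Fin d → Fin 2)} (hl : (w :: l).Pairwise (· < ·))
    (hm : ∀ x, x ∈ w :: l ↔ m x ≠ 0) (v : Fin d → Fin 2) :
    chainDegree (m + Finsupp.single v 1) (chainInsert v (w :: l)) =
      (if v = 0 then if v < w then
        (-1) ^ (m w - 1) * ((m w - 1).choose (rank w - 1) : ℤ) *
          tailDegree m w (m w - rank w) l else 0 else 0) +
      (if v = w then
        (-1) ^ (m w) * ((m w).choose (rank w) : ℤ) * tailDegree m w (m w - rank w) l else 0) +
      (-1) ^ (m w - 1) * ((m w - 1).choose (rank w) : ℤ) *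
        tailDegree (m + Finsupp.single v 1) w (m w - 1 - rank w) (chainInsert v l) := by
  have hl' := (List.pairwise_cons.1 hl).1
  rw [chainInsert]
  by_cases h1 : v = w
  · subst h1
    rw [if_pos rfl, if_neg (lt_irrefl v), if_pos rfl,
      tailDegree_chainInsert_eq_zero _ (lt_irrefl _), chainDegree,
      tailDegree_congr (m' := m) (fun x hx => by simp [(hl' x hx).ne'])]
    simp
  · rw [if_neg h1, if_neg h1, add_zero]
    by_cases h2 : v < w
    · have hmv : m v = 0 := by
        by_contra h
        rcases List.mem_cons.1 ((hm v).2 h) with rfl | h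
        · exact h1 rfl
        · exact lt_asymm h2 (hl' v h)
      rw [if_pos h2, if_pos h2, tailDegree_chainInsert_eq_zero _ h2.asymm, mul_zero, add_zero,
        chainDegree]
      have hm1 : (m + Finsupp.single v 1 : (Fin d → Fin 2) →₀ ℕ) v = 1 := by simp [hmv]
      have hmw : (m + Finsupp.single v 1 : (Fin d → Fin 2) →₀ ℕ) w = m w := by simp [h2.ne']
      rw [hm1]
      split_ifs with h3
      · subst h3
        rw [tailDegree, if_pos h2, hmw, tailDegree_congr (m' := m)
          (fun x hx => by simp [(h2.trans (hl' x hx)).ne'])]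
        simp [rank_zero]
      · have : rank v ≠ 0 := fun h => h3 (eq_zero_of_rank_eq h)
        rw [Nat.choose_eq_zero_of_lt (by omega)]
        simp
    · rw [if_neg h2, if_neg h2, chainDegree]
      simp [Ne.symm h1]

theorem chainDegree_sum_cons {m : (Fin d → Fin 2) →₀ ℕ} {w : Fin d → Fin 2}
    {l : List (Fin d → Fin 2)} (hl : (w :: l).Pairwise (· < ·))
    (hm : ∀ x, x ∈ w :: l ↔ m x ≠ 0) (F : (Fin d → Fin 2) → Prop) [DecidablePred F] :
    ∑ v with F v, chainDegree (m + Finsupp.single v 1) (chainInsert v (w :: l)) =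
      (if F 0 then if 0 < w then
        (-1) ^ (m w - 1) * ((m w - 1).choose (rank w - 1) : ℤ) *
          tailDegree m w (m w - rank w) l else 0 else 0) +
      (if F w then
        (-1) ^ (m w) * ((m w).choose (rank w) : ℤ) * tailDegree m w (m w - rank w) l else 0) +
      (-1) ^ (m w - 1) * ((m w - 1).choose (rank w) : ℤ) *
        ∑ v with F v,
          tailDegree (m + Finsupp.single v 1) w (m w - 1 - rank w) (chainInsert v l) := by
  rw [sum_congr rfl fun v _ => chainDegree_insert_cons hl hm v, sum_add_distrib,
    sum_add_distrib, ← mul_sum, sum_ite_eq', sum_ite_eq']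
  simp

/-- With $r$ the rank of the first vertex and $\mu+1$ its multiplicity, the coefficients are
$\binom\mu{r-1}-\binom{\mu+1}r+\binom\mu r=0$ up to sign; for $r=0$ the first one is absent. -/
theorem chainDegree_sum {m : (Fin d → Fin 2) →₀ ℕ} {l : List (Fin d → Fin 2)}
    (hl : l.Pairwise (· < ·)) (hm : ∀ x, x ∈ l ↔ m x ≠ 0) (hne : l ≠ []) :
    ∑ v, chainDegree (m + Finsupp.single v 1) (chainInsert v l) = 0 := by
  obtain ⟨w, l, rfl⟩ := List.exists_cons_of_ne_nil hne
  have hs := chainDegree_sum_cons hl hm fun _ => True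
  simp only [filter_true, if_true] at hs
  have hmw : m w ≠ 0 := (hm w).1 List.mem_cons_self
  have hm' (x) (hx : w < x) : x ∈ l ↔ m x ≠ 0 := by
    rw [← hm x, List.mem_cons, or_iff_right hx.ne']
  rw [hs, tailDegree_sum hl hm']
  obtain ⟨μ, hμ⟩ := Nat.exists_eq_succ_of_ne_zero hmw
  rw [hμ]
  simp only [Nat.succ_eq_add_one, Nat.add_sub_cancel]
  rcases Nat.eq_zero_or_eq_succ_pred (rank w) with h | h
  · obtain rfl := eq_zero_of_rank_eq h
    simp only [lt_irrefl, if_false, h, Nat.choose_zero_right, Nat.sub_zero]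
    push_cast
    ring
  · have hw : 0 < w := by
      refine lt_of_le_of_ne (fun i => Fin.zero_le _) ?_
      rintro rfl
      rw [rank_zero] at h
      omega
    rw [if_pos hw]
    generalize rank w = r at *
    obtain ⟨k, rfl⟩ : ∃ k, r = k + 1 := ⟨_, h⟩
    rw [Nat.choose_succ_succ, Nat.add_sub_cancel]
    rcases lt_or_ge μ (k + 1) with h | h
    · rw [Nat.choose_eq_zero_of_lt h]
      push_cast
      ring
    · rw [show μ - (k + 1) + 1 = μ + 1 - (k + 1) by omega]
      push_cast
      ring

/-- The chain starts outside the half space, so neither 0 nor the first vertex is counted, and the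
sum over the tail vanishes. -/
theorem chainDegree_sum_apply_eq_one {m : (Fin d → Fin 2) →₀ ℕ} {l : List (Fin d → Fin 2)}
    (hl : l.Pairwise (· < ·)) (hm : ∀ x, x ∈ l ↔ m x ≠ 0) {i : Fin d}
    (h0 : ∃ x ∈ l, x i = 0) (h1 : ∃ x ∈ l, x i = 1) :
    ∑ v with v i = 1, chainDegree (m + Finsupp.single v 1) (chainInsert v l) = 0 := by
  cases l with
  | nil => simp at h0
  | cons w l =>
    have hm' (x) (hx : w < x) : x ∈ l ↔ m x ≠ 0 := by
      rw [← hm x, List.mem_cons, or_iff_right hx.ne']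
    have hw : w i = 0 := by
      obtain ⟨x, hx, hx0⟩ := h0
      rcases List.mem_cons.1 hx with rfl | hx
      · exact hx0
      · have : w i ≤ x i := ((List.pairwise_cons.1 hl).1 x hx).le i
        omega
    rw [chainDegree_sum_cons hl hm fun v => v i = 1, tailDegree_sum_apply_eq_one hl hm' hw]
    · simp [hw]
    · obtain ⟨x, hx, hx1⟩ := h1
      rcases List.mem_cons.1 hx with rfl | hx
      · omega
      · exact ⟨x, hx, hx1⟩

/-- The strictly increasing list `l` consists of the vertices that occur in the monomial `m`. -/
def IsChainOf (m : (Fin d → Fin 2) →₀ ℕ) (l : List (Fin d → Fin 2)) : Prop :=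
  l.Pairwise (· < ·) ∧ ∀ x, x ∈ l ↔ m x ≠ 0

theorem IsChainOf.unique {m : (Fin d → Fin 2) →₀ ℕ} {l l' : List (Fin d → Fin 2)}
    (h : IsChainOf m l) (h' : IsChainOf m l') : l = l' :=
  h.1.eq_of_mem_iff h'.1 fun {x} => (h.2 x).trans (h'.2 x).symm

theorem IsChainOf.comparable {m : (Fin d → Fin 2) →₀ ℕ} {l : List (Fin d → Fin 2)}
    (h : IsChainOf m l) {x y : Fin d → Fin 2} (hx : m x ≠ 0) (hy : m y ≠ 0) :
    x ≤ y ∨ y ≤ x := by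
  have hp : l.Pairwise fun x y => x ≤ y ∨ y ≤ x := h.1.imp fun hab => Or.inl hab.le
  have : Std.Symm fun x y : Fin d → Fin 2 => x ≤ y ∨ y ≤ x := ⟨fun _ _ hab => Or.symm hab⟩
  exact List.Pairwise.forall_of_forall (R := fun x y : Fin d → Fin 2 => x ≤ y ∨ y ≤ x)
    (fun _ _ => Or.inl le_rfl) hp ((h.2 x).2 hx) ((h.2 y).2 hy)

theorem IsChainOf.filter {m m' : (Fin d → Fin 2) →₀ ℕ} {l : List (Fin d → Fin 2)}
    (h : IsChainOf m l) (hm : ∀ x, m' x ≠ 0 → m x ≠ 0) :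
    IsChainOf m' (l.filter fun x => m' x ≠ 0) := by
  refine ⟨h.1.filter _, fun x => ?_⟩
  rw [List.mem_filter, h.2]
  simpa using hm x

/-- The degree of the monomial with multiplicities `m`. -/
noncomputable def monomialDegree (m : (Fin d → Fin 2) →₀ ℕ) : ℤ :=
  if h : ∃ l, IsChainOf m l then chainDegree m h.choose else 0

theorem IsChainOf.monomialDegree_eq {m : (Fin d → Fin 2) →₀ ℕ} {l : List (Fin d → Fin 2)}
    (h : IsChainOf m l) : monomialDegree m = chainDegree m l := by
  have he : ∃ l, IsChainOf m l := ⟨l, h⟩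
  rw [monomialDegree, dif_pos he, he.choose_spec.unique h]

theorem IsChainOf.monomialDegree_add {m : (Fin d → Fin 2) →₀ ℕ} {l : List (Fin d → Fin 2)}
    (h : IsChainOf m l) (v : Fin d → Fin 2) :
    monomialDegree (m + Finsupp.single v 1) =
      chainDegree (m + Finsupp.single v 1) (chainInsert v l) := by
  by_cases hp : (chainInsert v l).Pairwise (· < ·)
  · refine IsChainOf.monomialDegree_eq ⟨hp, fun x => ?_⟩
    rw [mem_chainInsert, h.2, Finsupp.add_apply]
    rcases eq_or_ne x v with rfl | hx
    · simp
    · simp [hx]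
  · rw [chainDegree_eq_zero hp, monomialDegree, dif_neg]
    rintro ⟨l', hl'⟩
    refine hp (pairwise_chainInsert h.1 fun x hx => hl'.comparable ?_ ?_)
    · have := (h.2 x).1 hx
      simp [this]
    · simp

/-- The support only grows under multiplication, and subsets of chains are chains. -/
theorem monomialDegree_add_eq_zero {m : (Fin d → Fin 2) →₀ ℕ} (h : ¬ ∃ l, IsChainOf m l)
    (n : (Fin d → Fin 2) →₀ ℕ) : monomialDegree (m + n) = 0 := by
  rw [monomialDegree, dif_neg]
  rintro ⟨l, hl⟩
  refine h ⟨_, hl.filter fun x hx => ?_⟩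
  simp [hx]

theorem monomialDegree_sum {m : (Fin d → Fin 2) →₀ ℕ} (hm : m ≠ 0) :
    ∑ v, monomialDegree (m + Finsupp.single v 1) = 0 := by
  by_cases h : ∃ l, IsChainOf m l
  · obtain ⟨l, hl⟩ := h
    simp only [hl.monomialDegree_add]
    refine chainDegree_sum hl.1 hl.2 ?_
    rintro rfl
    refine hm (Finsupp.ext fun x => ?_)
    simpa using hl.2 x
  · simp [monomialDegree_add_eq_zero h]

theorem monomialDegree_sum_slice {m : (Fin d → Fin 2) →₀ ℕ} {u w : Fin d → Fin 2}
    (hu : m u ≠ 0) (hw : m w ≠ 0) {i : Fin d} (hi : u i ≠ w i) :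
    ∑ v with v i = u i, monomialDegree (m + Finsupp.single v 1) = 0 := by
  by_cases h : ∃ l, IsChainOf m l
  · obtain ⟨l, hl⟩ := h
    have h1 : ∑ v with v i = 1, monomialDegree (m + Finsupp.single v 1) = 0 := by
      simp only [hl.monomialDegree_add]
      rcases (show u i = 0 ∧ w i = 1 ∨ u i = 1 ∧ w i = 0 by omega) with h | h
      · exact chainDegree_sum_apply_eq_one hl.1 hl.2 ⟨u, (hl.2 u).2 hu, h.1⟩
          ⟨w, (hl.2 w).2 hw, h.2⟩
      · exact chainDegree_sum_apply_eq_one hl.1 hl.2 ⟨w, (hl.2 w).2 hw, h.2⟩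
          ⟨u, (hl.2 u).2 hu, h.1⟩
    rcases (show u i = 0 ∨ u i = 1 by omega) with h | h
    -- The slice `v i = 0` is the total sum minus the slice `v i = 1`.
    · have ht := monomialDegree_sum (m := m) (by rintro rfl; simp at hu)
      rw [← sum_filter_add_sum_filter_not univ (fun v => v i = 1), h1, zero_add] at ht
      rw [← ht, h]
      refine sum_congr (filter_congr fun v _ => ?_) fun _ _ => rfl
      omega
    · rw [h, h1]
  · simp [monomialDegree_add_eq_zero h]

/-- Along a chain a coordinate with values in {0, 1} rises at most once, so disjointness is
automatic. Sorting by rank puts the vertices in order. -/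
theorem formSimplex_of_comparable {k : ℕ} {v : Fin (k + 1) → Fin d → Fin 2}
    (h : ∀ j l, v j ≤ v l ∨ v l ≤ v j) : FormSimplex (hypercube d) v := by
  refine ⟨Tuple.sort fun j => rank (v j), ?_⟩
  set π := Tuple.sort fun j => rank (v j)
  have hs : Monotone ((fun j => rank (v j)) ∘ π) := Tuple.monotone_sort _
  have hmono : Monotone (v ∘ π) := by
    intro a b hab
    rcases h (π a) (π b) with h | h
    · exact h
    · rcases h.lt_or_eq with h | h
      · have h1 := rank_strictMono h
        have h2 : rank (v (π a)) ≤ rank (v (π b)) := hs hab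
        omega
      · exact h.ge
  refine ⟨fun j => ⟨hmono j.castSucc_le_succ, fun i hi => hi.ne⟩, ?_⟩
  have key (j l : Fin k) (hjl : j < l) : Disjoint (moved ((v ∘ π) j.castSucc) ((v ∘ π) j.succ))
      (moved ((v ∘ π) l.castSucc) ((v ∘ π) l.succ)) := by
    refine Set.disjoint_left.2 fun i hi hi' => ?_
    have h1 : (v ∘ π) j.castSucc i < (v ∘ π) j.succ i := hi
    have h2 : (v ∘ π) l.castSucc i < (v ∘ π) l.succ i := hi'
    have h3 : (v ∘ π) j.succ i ≤ (v ∘ π) l.castSucc i :=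
      hmono (Fin.succ_le_castSucc_iff.2 hjl) i
    omega
  intro j l hjl
  rcases lt_or_gt_of_ne hjl with h | h
  · exact key j l h
  · exact (key l j h).symm

/-- The degree functional on polynomials in the vertices of the hypercube. -/
noncomputable def polyDegree (d : ℕ) : MvPolynomial (Fin d → Fin 2) ℤ →ₗ[ℤ] ℤ :=
  (basisMonomials (Fin d → Fin 2) ℤ).constr ℤ monomialDegree

theorem polyDegree_monomial (m : (Fin d → Fin 2) →₀ ℕ) (c : ℤ) :
    polyDegree d (monomial m c) = c * monomialDegree m := by
  have h : monomial m c = c • basisMonomials (Fin d → Fin 2) ℤ m := by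
    rw [coe_basisMonomials, smul_monomial, smul_eq_mul, mul_one]
  rw [h, map_smul, polyDegree, Module.Basis.constr_basis, smul_eq_mul]

theorem prod_X_eq_monomial {ι σ : Type*} (s : Finset ι) (v : ι → σ) :
    ∏ j ∈ s, (X (v j) : MvPolynomial σ ℤ) = monomial (∑ j ∈ s, Finsupp.single (v j) 1) 1 :=
  (monomial_sum_one s _).symm

theorem polyDegree_eq_zero {x : MvPolynomial (Fin d → Fin 2) ℤ}
    (hx : x ∈ ratIdeal (hypercube d)) : polyDegree d x = 0 := by
  -- The functional is only additive, so the ideal coefficients are absorbed into `a`, which may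
  -- then be taken to be a monomial.
  suffices h : ∀ a, polyDegree d (a * x) = 0 by simpa using h 1
  induction hx using Submodule.span_induction with
  | zero => simp
  | add x y _ _ hx hy => intro a; rw [mul_add, map_add, hx, hy, add_zero]
  | smul b x _ hx => intro a; rw [smul_eq_mul, ← mul_assoc]; exact hx _
  | mem x hx =>
    intro a
    induction a using MvPolynomial.induction_on' with
    | add p q hp hq => rw [add_mul, map_add, hp, hq, add_zero]
    | monomial n c =>
      rcases hx with (⟨k, v, hv, rfl⟩ | ⟨u, rfl⟩) | ⟨u, w, i, hi, rfl⟩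
      · rw [prod_X_eq_monomial, monomial_mul, polyDegree_monomial, add_comm n,
          monomialDegree_add_eq_zero, mul_zero]
        rintro ⟨l, hl⟩
        refine hv (formSimplex_of_comparable fun j l => hl.comparable ?_ ?_)
        · rw [Finsupp.finsetSum_apply]
          exact (sum_pos' (fun _ _ => Nat.zero_le _) ⟨j, mem_univ _, by simp⟩).ne'
        · rw [Finsupp.finsetSum_apply]
          exact (sum_pos' (fun _ _ => Nat.zero_le _) ⟨l, mem_univ _, by simp⟩).ne'
      · have h (v : Fin d → Fin 2) : monomial n c * (X u * X v) =
            monomial (n + Finsupp.single u 1 + Finsupp.single v 1) c := by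
          simp only [X, monomial_mul, mul_one, add_assoc]
        simp only [mul_sum, h, map_sum, polyDegree_monomial]
        rw [← mul_sum, monomialDegree_sum, mul_zero]
        intro h0
        simpa using DFunLike.congr_fun h0 u
      · have h (v : Fin d → Fin 2) : monomial n c * (X u * X w * X v) =
            monomial (n + Finsupp.single u 1 + Finsupp.single w 1 + Finsupp.single v 1) c := by
          simp only [X, monomial_mul, mul_one, add_assoc]
        simp only [mul_sum, h, map_sum, polyDegree_monomial]
        rw [← mul_sum, monomialDegree_sum_slice (by simp) (by simp) hi, mul_zero]

/-- The degree functional on the Chow ring of the hypercube. -/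
noncomputable def chowDegree (d : ℕ) : Chow (hypercube d) →ₗ[ℤ] ℤ :=
  ((ratIdeal (hypercube d)).restrictScalars ℤ).liftQ (polyDegree d) fun _ hx =>
    polyDegree_eq_zero hx

theorem tailDegree_eq_one {m : (Fin d → Fin 2) →₀ ℕ} {p : Fin d → Fin 2}
    {l : List (Fin d → Fin 2)} (hl : (p :: l).Pairwise (· < ·)) (hm : ∀ x ∈ l, m x = 1)
    (hlen : rank p + l.length = d) : tailDegree m p 0 l = 1 := by
  induction l generalizing p with
  | nil => simpa [tailDegree] using hlen
  | cons w l ih =>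
    obtain ⟨hpl, hl'⟩ := List.pairwise_cons.1 hl
    have hpw := hpl w List.mem_cons_self
    have hr := rank_strictMono hpw
    -- Ranks increase strictly and stay at most `d`; a chain of the prescribed length must therefore
    -- rise by one at every step.
    have hlen' : ∀ (q : Fin d → Fin 2) (l : List (Fin d → Fin 2)), (q :: l).Pairwise (· < ·) →
        rank q + l.length ≤ d := by
      intro q l
      induction l generalizing q with
      | nil => intro _; simpa using rank_le q
      | cons x l ih =>
        intro h
        have h1 := ih x (List.pairwise_cons.1 h).2
        have h2 := rank_strictMono ((List.pairwise_cons.1 h).1 x List.mem_cons_self)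
        rw [List.length_cons]
        omega
    have h1 := hlen' w l hl'
    rw [List.length_cons] at hlen
    have h2 : rank w - rank p = 1 := by omega
    rw [tailDegree, if_pos hpw, hm w List.mem_cons_self, h2,
      ih hl' (fun x hx => hm x (List.mem_cons_of_mem _ hx)) (by omega)]
    simp

theorem chowDegree_simplexClass (σ : NDSimplex (hypercube d) d) :
    chowDegree d (simplexClass (hypercube d) σ) = 1 := by
  have hσ := σ.2.2
  set m : (Fin d → Fin 2) →₀ ℕ := ∑ j, Finsupp.single (σ.1 j) 1 with hmdef
  have hm (j : Fin (d + 1)) : m (σ.1 j) = 1 := by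
    rw [hmdef, Finsupp.finsetSum_apply]
    simp [Finsupp.single_apply, hσ.injective.eq_iff]
  have hchain : IsChainOf m (List.ofFn σ.1) := by
    refine ⟨List.pairwise_ofFn.2 fun i j hij => hσ hij, fun x => ?_⟩
    rw [List.mem_ofFn]
    constructor
    · rintro ⟨j, rfl⟩
      rw [hm j]
      exact one_ne_zero
    · intro h
      by_contra hx
      refine h ?_
      rw [hmdef, Finsupp.finsetSum_apply]
      refine sum_eq_zero fun j _ => Finsupp.single_eq_of_ne fun h => hx ⟨j, h.symm⟩
  have h0 : rank (σ.1 0) = 0 := by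
    have key (j : Fin (d + 1)) : rank (σ.1 0) + j ≤ rank (σ.1 j) := by
      induction j using Fin.induction with
      | zero => simp
      | succ j ih =>
        have := rank_strictMono (hσ j.castSucc_lt_succ)
        simp only [Fin.val_castSucc, Fin.val_succ] at ih ⊢
        omega
    have h1 := key (Fin.last d)
    have h2 := rank_le (σ.1 (Fin.last d))
    simp only [Fin.val_last] at h1
    omega
  change polyDegree d (∏ j, X (σ.1 j)) = 1
  rw [prod_X_eq_monomial, polyDegree_monomial, one_mul, hchain.monomialDegree_eq]
  have hl := hchain.1
  rw [List.ofFn_succ] at hl ⊢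
  rw [chainDegree, hm, h0, tailDegree_eq_one hl]
  · simp
  · intro x hx
    obtain ⟨j, rfl⟩ := List.mem_ofFn.1 hx
    exact hm _
  · simp [h0]

end HypercubeDegree

/-! ### Simplices in general products, and maximal flags. -/

section Simplices

variable {d : ℕ} {V : Fin d → Type u} [∀ i, LinearOrder (V i)] {G : ∀ i, SimpleGraph (V i)}

theorem IsSimplex.monotone {k : ℕ} {σ : Fin (k + 1) → ∀ i, V i} (h : IsSimplex G σ) :
    Monotone σ :=
  Fin.monotone_iff_le_succ.2 fun j => (h.step j).1

/-- In a simplex every coordinate moves at most once. -/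
theorem IsSimplex.eq_or_eq {k : ℕ} {σ : Fin (k + 1) → ∀ i, V i} (h : IsSimplex G σ)
    {a b c : Fin (k + 1)} (hab : a ≤ b) (hbc : b ≤ c) (i : Fin d) :
    σ a i = σ b i ∨ σ b i = σ c i := by
  have key (a b : Fin (k + 1)) (hab : a ≤ b) (hne : σ a i ≠ σ b i) :
      ∃ j : Fin k, a ≤ j.castSucc ∧ j.succ ≤ b ∧ i ∈ moved (σ j.castSucc) (σ j.succ) := by
    induction b using Fin.induction with
    | zero => exact absurd (by rw [Fin.le_zero_iff.1 hab]) hne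
    | succ b ih =>
      rcases hab.eq_or_lt with rfl | hlt
      · exact absurd rfl hne
      · have hle : a ≤ b.castSucc := Fin.le_castSucc_iff.2 hlt
        by_cases hb : σ b.castSucc i < σ b.succ i
        · exact ⟨b, hle, le_rfl, hb⟩
        · have heq : σ b.castSucc i = σ b.succ i :=
            (h.monotone b.castSucc_le_succ i).eq_of_not_lt hb
          obtain ⟨j, h1, h2, h3⟩ := ih hle (by rwa [heq])
          exact ⟨j, h1, h2.trans b.castSucc_le_succ, h3⟩
  by_contra! hne
  obtain ⟨j, -, hj, hj'⟩ := key a b hab hne.1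
  obtain ⟨l, hl, -, hl'⟩ := key b c hbc hne.2
  have hjl : j ≠ l := by
    rintro rfl
    exact absurd (hj.trans hl) (not_le.2 j.castSucc_lt_succ)
  exact Set.disjoint_left.1 (h.disjoint hjl) hj' hl'

theorem FormSimplex.comparable {k : ℕ} {v : Fin (k + 1) → ∀ i, V i} (h : FormSimplex G v)
    (j l : Fin (k + 1)) : v j ≤ v l ∨ v l ≤ v j := by
  obtain ⟨π, hπ⟩ := h
  have hm := hπ.monotone
  rcases le_total (π.symm j) (π.symm l) with h | h
  · left; simpa using hm h
  · right; simpa using hm h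

theorem FormSimplex.eq_or_eq {k : ℕ} {v : Fin (k + 1) → ∀ i, V i} (h : FormSimplex G v)
    {a b c : Fin (k + 1)} (hab : v a ≤ v b) (hbc : v b ≤ v c) (i : Fin d) :
    v a i = v b i ∨ v b i = v c i := by
  obtain ⟨π, hπ⟩ := h
  have hm := hπ.monotone
  rcases le_total (π.symm a) (π.symm b) with h1 | h1
  · rcases le_total (π.symm b) (π.symm c) with h2 | h2
    · simpa using hπ.eq_or_eq h1 h2 i
    · right
      have : v c ≤ v b := by simpa using hm h2
      rw [le_antisymm hbc this]
  · left
    have : v b ≤ v a := by simpa using hm h1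
    rw [le_antisymm hab this]

/-- The vertices of the maximal simplex of the hypercube that moves the coordinates in the order
given by a permutation. -/
def flagVertex (π : Equiv.Perm (Fin d)) (j : Fin (d + 1)) : Fin d → Fin 2 :=
  fun i => if (π.symm i).castSucc < j then 1 else 0

theorem flagVertex_castSucc_lt_succ_iff (π : Equiv.Perm (Fin d)) (j i : Fin d) :
    flagVertex π j.castSucc i < flagVertex π j.succ i ↔ i = π j := by
  simp only [flagVertex, Fin.castSucc_lt_castSucc_iff, Fin.castSucc_lt_succ_iff,
    ← Equiv.symm_apply_eq]
  rcases lt_trichotomy (π.symm i) j with h | h | h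
  · simp [h, h.le, h.ne]
  · simp [h]
  · simp [h.not_gt, h.not_ge, h.ne']

theorem flagVertex_mono (π : Equiv.Perm (Fin d)) : Monotone (flagVertex π) := by
  intro a b hab i
  change flagVertex π a i ≤ flagVertex π b i
  simp only [flagVertex]
  split_ifs with h1 h2
  · exact le_rfl
  · exact absurd (h1.trans_le hab) h2
  · exact Fin.zero_le _
  · exact le_rfl

theorem prod_update {k : ℕ} {α : Type*} (f : Fin (k + 1) → α) (q : Fin (k + 1)) (v : α) :
    (∏ j, X (Function.update f q v j) : MvPolynomial α ℤ) =
      (∏ j ∈ univ.erase q, X (f j)) * X v := by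
  rw [← mul_prod_erase univ _ (mem_univ q), Function.update_self, mul_comm]
  congr 1
  refine prod_congr rfl fun j hj => ?_
  rw [Function.update_of_ne (ne_of_mem_erase hj)]

end Simplices

section CubeVertex

variable {d : ℕ} {V : Fin d → Type u} [∀ i, LinearOrder (V i)] {G : ∀ i, SimpleGraph (V i)}

theorem cubeVertex_eq_of_lt {e : Cube G} {i : Fin d} {a b : V i} (he : (e i).1 = s(a, b))
    (hab : a < b) (z : Fin d → Fin 2) : cubeVertex e z i = if z i = 0 then a else b := by
  simp [cubeVertex, he, hab.le]

end CubeVertex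

/-! ### Maximal simplices of a cube and independence of the order of directions. -/

section Flags

variable {d : ℕ} {V : Fin d → Type u} [∀ i, LinearOrder (V i)] [∀ i, Fintype (V i)]
  {G : ∀ i, SimpleGraph (V i)}

theorem cubeVertex_mono (e : Cube G) : Monotone (cubeVertex e) := by
  intro a b hab i
  rw [← not_lt, cubeVertex_lt_iff, not_lt]
  exact hab i

/-- The maximal simplex of the cube `e` that moves the coordinates in the order given by a
permutation. -/
def flagSimplex (e : Cube G) (π : Equiv.Perm (Fin d)) : NDSimplex G d := by
  refine ⟨fun j => cubeVertex e (flagVertex π j), ⟨fun j => ⟨?_, fun i hi => ?_⟩, ?_⟩, ?_⟩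
  · exact cubeVertex_mono e (flagVertex_mono π j.castSucc_le_succ)
  · exact cubeVertex_adj e ((cubeVertex_lt_iff e _ _ i).1 hi)
  · intro j l hjl
    refine Set.disjoint_left.2 fun i hi hi' => hjl (π.injective ?_)
    rw [← (flagVertex_castSucc_lt_succ_iff π j i).1 ((cubeVertex_lt_iff e _ _ i).1 hi),
      ← (flagVertex_castSucc_lt_succ_iff π l i).1 ((cubeVertex_lt_iff e _ _ i).1 hi')]
  · refine Fin.strictMono_iff_lt_succ.2 fun j => Pi.lt_def.2
      ⟨cubeVertex_mono e (flagVertex_mono π j.castSucc_le_succ), π j, ?_⟩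
    rw [cubeVertex_lt_iff, flagVertex_castSucc_lt_succ_iff]

theorem flagSimplex_apply (e : Cube G) (π : Equiv.Perm (Fin d)) (j : Fin (d + 1)) :
    (flagSimplex e π).1 j = cubeVertex e (flagVertex π j) := rfl

/-- Every non-degenerate `d`-simplex is a maximal simplex of a cube. -/
theorem exists_flagSimplex_eq (σ : NDSimplex G d) : ∃ e π, flagSimplex e π = σ := by
  obtain ⟨σ, hσ, hmono⟩ := σ
  have hex (j : Fin d) : ∃ i, i ∈ moved (σ j.castSucc) (σ j.succ) :=
    (Pi.lt_def.1 (hmono j.castSucc_lt_succ)).2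
  choose f hf using hex
  -- There are `d` nonempty disjoint moved sets among `d` coordinates, so choosing one coordinate
  -- per step is a bijection.
  have hinj : Function.Injective f := by
    intro j l hjl
    by_contra hne
    exact Set.disjoint_left.1 (hσ.disjoint hne) (hf j) (hjl ▸ hf l)
  let π : Equiv.Perm (Fin d) := Equiv.ofBijective f (Finite.injective_iff_bijective.1 hinj)
  have hπ (j) : π j ∈ moved (σ j.castSucc) (σ j.succ) := hf j
  have hlt (i) : σ (π.symm i).castSucc i < σ (π.symm i).succ i := by
    simpa [moved] using hπ (π.symm i)
  let e : Cube G := fun i => ⟨s(σ (π.symm i).castSucc i, σ (π.symm i).succ i),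
    (hσ.step (π.symm i)).2 i (hlt i)⟩
  refine ⟨e, π, Subtype.ext (funext fun j => funext fun i => ?_)⟩
  rw [flagSimplex_apply, cubeVertex_eq_of_lt (e := e) rfl (hlt i)]
  have hc {a b : Fin (d + 1)} (hab : a ≤ b) : σ a i ≤ σ b i := hσ.monotone hab i
  simp only [flagVertex]
  by_cases h : (π.symm i).castSucc < j
  · have h' : (π.symm i).succ ≤ j := Fin.castSucc_lt_iff_succ_le.1 h
    simp only [h, if_true, one_ne_zero, if_false]
    exact (hσ.eq_or_eq (Fin.castSucc_le_succ _) h' i).resolve_left (hlt i).ne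
  · simp only [h, if_false, if_true]
    exact ((hσ.eq_or_eq (not_lt.1 h) (Fin.castSucc_le_succ _) i).resolve_right (hlt i).ne).symm

theorem prod_X_mem_ratIdeal {k : ℕ} {v : Fin (k + 1) → ∀ i, V i}
    (h : ¬ FormSimplex G v) : (∏ j, X (v j) : MvPolynomial (∀ i, V i) ℤ) ∈ ratIdeal G :=
  Ideal.subset_span (Or.inl (Or.inl ⟨k, v, h, rfl⟩))

theorem prod_slice_mem_ratIdeal {ι : Type*} (s : Finset ι) (f : ι → ∀ i, V i) {j l : ι}
    (hj : j ∈ s) (hl : l ∈ s) {i : Fin d} (hi : f j i ≠ f l i) :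
    (∏ r ∈ s, X (f r)) * ∑ v : (∀ i, V i) with v i = f j i, X v ∈ ratIdeal G := by
  have hjl : j ≠ l := by rintro rfl; exact hi rfl
  rw [← mul_prod_erase s _ hj, ← mul_prod_erase (s.erase j) _ (mem_erase.2 ⟨hjl.symm, hl⟩),
    ← mul_assoc, mul_right_comm]
  exact Ideal.mul_mem_right _ _ (Ideal.subset_span (Or.inr ⟨f j, f l, i, hi, rfl⟩))

theorem prod_total_mem_ratIdeal {ι : Type*} (s : Finset ι) (f : ι → ∀ i, V i) {j : ι}
    (hj : j ∈ s) : (∏ r ∈ s, X (f r)) * ∑ v : (∀ i, V i), X v ∈ ratIdeal G := by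
  rw [← mul_prod_erase s _ hj, mul_right_comm]
  exact Ideal.mul_mem_right _ _ (Ideal.subset_span (Or.inl (Or.inr ⟨f j, rfl⟩)))

/-- If only the coordinates `i` and `i'` move between the vertices `f j₀` and `f j₁`, then
moving `i'` first is, up to sign, the sum over the vertices `v` with `v i = f j₀ i` and
`v i' = f j₀ i'`. -/
theorem prod_mul_add_mem_ratIdeal {k : ℕ} (f : Fin (k + 1) → ∀ i, V i) {q j₀ j₁ : Fin (k + 1)}
    (h0 : j₀ ≠ q) (h1 : j₁ ≠ q) {i i' : Fin d}
    (hii : i ≠ i') (hi : f j₀ i < f j₁ i) (hi' : f j₀ i' < f j₁ i')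
    (hc : ∀ c, c ≠ i → c ≠ i' → f j₀ c = f j₁ c) :
    (∏ j ∈ univ.erase q, X (f j)) * (X (Function.update (f j₀) i' (f j₁ i')) +
      ∑ v : (∀ i, V i) with v i = f j₀ i ∧ v i' = f j₀ i', X v) ∈ ratIdeal G := by
  have hs := prod_slice_mem_ratIdeal (G := G) (univ.erase q) f (i := i)
    (mem_erase.2 ⟨h0, mem_univ j₀⟩) (mem_erase.2 ⟨h1, mem_univ j₁⟩) hi.ne
  set y := Function.update (f j₀) i' (f j₁ i') with hy
  have hyi : y i = f j₀ i := by simp [hy, hii]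
  have hyi' : y i' = f j₁ i' := by simp [hy]
  -- The slice at `i` is split by whether `i'` has moved; among the vertices where it has, all but
  -- `y` will give non-simplices.
  rw [← sum_filter_add_sum_filter_not _ (fun v => v i' = f j₀ i'), filter_filter, filter_filter,
    ← add_sum_erase {v | v i = f j₀ i ∧ ¬ v i' = f j₀ i'} _ (a := y)] at hs
  · rw [← Ideal.add_mem_iff_left (b := (∏ j ∈ univ.erase q, X (f j)) *
      ∑ v ∈ ({v | v i = f j₀ i ∧ ¬ v i' = f j₀ i'} : Finset (∀ i, V i)).erase y, X v), ← mul_add]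
    · convert hs using 2
      abel
    · rw [mul_sum]
      refine Ideal.sum_mem _ fun v hv => ?_
      simp only [mem_erase, mem_filter, mem_univ, true_and] at hv
      obtain ⟨hvy, hvi, hvi'⟩ := hv
      rw [← prod_update]
      refine prod_X_mem_ratIdeal fun hF => hvy ?_
      have hq : Function.update f q v q = v := Function.update_self ..
      have hq0 : Function.update f q v j₀ = f j₀ := Function.update_of_ne h0 ..
      have hq1 : Function.update f q v j₁ = f j₁ := Function.update_of_ne h1 ..
      -- If `v` completes a simplex it lies between `f j₀` and `f j₁`, and its coordinate `i'`,
      -- having moved, is already final. This forces `v = y`.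
      have hle : f j₀ ≤ f j₁ := by
        rcases hF.comparable j₀ j₁ with h | h
        · rwa [hq0, hq1] at h
        · rw [hq0, hq1] at h
          exact absurd (h i) (not_le.2 hi)
      have hv0 : f j₀ ≤ v := by
        rcases hF.comparable j₀ q with h | h
        · rwa [hq0, hq] at h
        · have := hF.eq_or_eq h (c := j₁) (by rwa [hq0, hq1]) i'
          rw [hq0, hq1, hq] at this
          rcases this with h | h
          · exact absurd h hvi'
          · exact absurd h hi'.ne
      have hv1 : v ≤ f j₁ := by
        rcases hF.comparable q j₁ with h | h
        · rwa [hq1, hq] at h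
        · rw [hq1, hq] at h
          exact absurd ((h i).trans_eq hvi) (not_le.2 hi)
      funext c
      by_cases hci' : c = i'
      · subst hci'
        have := hF.eq_or_eq (a := j₀) (b := q) (c := j₁) (by rwa [hq0, hq]) (by rwa [hq1, hq]) c
        rw [hq0, hq1, hq] at this
        rw [hyi']
        exact this.resolve_left (Ne.symm hvi')
      · rw [hy, Function.update_of_ne hci']
        by_cases hci : c = i
        · subst hci
          exact hvi
        · exact le_antisymm ((hv1 c).trans_eq (hc c hci hci').symm) (hv0 c)
  · simp only [mem_filter, mem_univ, true_and]
    exact ⟨hyi, by rw [hyi']; exact hi'.ne'⟩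

/-- The classes of the maximal simplices of a cube whose orders of the coordinates differ by an
adjacent transposition are equal. -/
theorem simplexClass_flagSimplex_mul_swap {n : ℕ} {V : Fin (n + 1) → Type u}
    [∀ i, LinearOrder (V i)] [∀ i, Fintype (V i)] {G : ∀ i, SimpleGraph (V i)} (e : Cube G)
    (π : Equiv.Perm (Fin (n + 1))) (k : Fin n) :
    simplexClass G (flagSimplex e (π * Equiv.swap k.castSucc k.succ)) =
      simplexClass G (flagSimplex e π) := by
  set π' := π * Equiv.swap k.castSucc k.succ with hπ'
  set q : Fin (n + 2) := k.succ.castSucc with hq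
  set j₀ : Fin (n + 2) := k.castSucc.castSucc with hj₀
  set j₁ : Fin (n + 2) := k.succ.succ with hj₁
  set i := π k.castSucc with hi
  set i' := π k.succ with hi'
  set f : Fin (n + 2) → ∀ i, V i := fun j => cubeVertex e (flagVertex π j) with hf
  have hkk : k.castSucc ≠ k.succ := k.castSucc_lt_succ.ne
  have hii : i ≠ i' := fun h => hkk (π.injective h)
  have h0 : j₀ ≠ q := by simp [hj₀, hq, Fin.ext_iff]
  have h1 : j₁ ≠ q := by simp [hj₁, hq, Fin.ext_iff]
  have hflag (j : Fin (n + 2)) (c : Fin (n + 1)) :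
      flagVertex π j (π c) = if c.castSucc < j then 1 else 0 := by simp [flagVertex]
  have hflag' (j : Fin (n + 2)) (c : Fin (n + 1)) : flagVertex π' j (π c) =
      if (Equiv.swap k.castSucc k.succ c).castSucc < j then 1 else 0 := by
    have : π'.symm (π c) = Equiv.swap k.castSucc k.succ c := by
      rw [Equiv.symm_apply_eq, hπ', Equiv.Perm.mul_apply, Equiv.swap_apply_self]
    rw [flagVertex, this]
  have hother (c : Fin (n + 1)) (hc1 : c ≠ k.castSucc) (hc2 : c ≠ k.succ) (j j' : Fin (n + 2))
      (hj : (k : ℕ) ≤ j ∧ (j : ℕ) ≤ k + 2) (hj' : (k : ℕ) ≤ j' ∧ (j' : ℕ) ≤ k + 2) :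
      (if c.castSucc < j then (1 : Fin 2) else 0) = if c.castSucc < j' then 1 else 0 := by
    refine if_congr ?_ rfl rfl
    simp only [ne_eq, Fin.ext_iff, Fin.val_castSucc, Fin.val_succ, Fin.lt_def] at *
    omega
  have hlt (c : Fin (n + 1)) (hc : c = k.castSucc ∨ c = k.succ) : f j₀ (π c) < f j₁ (π c) := by
    rw [hf, cubeVertex_lt_iff, hflag, hflag, if_neg, if_pos]
    · exact Fin.zero_lt_one
    · rcases hc with rfl | rfl <;> simp [hj₁, Fin.lt_def]
    · rcases hc with rfl | rfl <;> simp [hj₀, Fin.lt_def]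
  have hc (c : Fin (n + 1)) (hci : c ≠ i) (hci' : c ≠ i') : f j₀ c = f j₁ c := by
    obtain ⟨c, rfl⟩ := π.surjective c
    rw [hf, cubeVertex_eq_iff, hflag, hflag, hother c (fun h => hci (by rw [h]))
      (fun h => hci' (by rw [h])) j₀ j₁ (by simp [hj₀]) (by simp [hj₁, add_assoc])]
  -- The remaining sum is symmetric in `i` and `i'`, so subtracting the two relations leaves the
  -- difference of the two flags: `hB` contains the original one, `hA` the swapped one.
  have hA := prod_mul_add_mem_ratIdeal (G := G) f h0 h1 hii (hlt _ (Or.inl rfl))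
    (hlt _ (Or.inr rfl)) hc
  have hB := prod_mul_add_mem_ratIdeal (G := G) f h0 h1 hii.symm (hlt _ (Or.inr rfl))
    (hlt _ (Or.inl rfl)) fun c hc1 hc2 => hc c hc2 hc1
  have hfq : Function.update f q (Function.update (f j₀) i (f j₁ i)) = f := by
    rw [Function.update_eq_self_iff]
    funext c
    obtain ⟨c, rfl⟩ := π.surjective c
    by_cases hci : c = k.castSucc
    · subst hci
      rw [Function.update_self, hf, cubeVertex_eq_iff, hflag, hflag, if_pos, if_pos] <;>
        simp [hj₁, hq, Fin.lt_def]
    · rw [Function.update_of_ne fun h => hci (π.injective h), hf, cubeVertex_eq_iff, hflag, hflag]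
      by_cases hci' : c = k.succ
      · subst hci'
        rw [if_neg, if_neg] <;> simp [hj₀, hq, Fin.lt_def]
      · rw [hother c hci hci' j₀ q (by simp [hj₀]) (by simp [hq])]
  have hfq' : Function.update f q (Function.update (f j₀) i' (f j₁ i')) =
      fun j => cubeVertex e (flagVertex π' j) := by
    funext j c
    obtain ⟨c, rfl⟩ := π.surjective c
    by_cases hj : j = q
    · subst hj
      rw [Function.update_self]
      by_cases hci' : c = k.succ
      · subst hci'
        rw [Function.update_self, hf, cubeVertex_eq_iff, hflag, hflag', Equiv.swap_apply_right,
          if_pos, if_pos] <;> simp [hj₁, hq, Fin.lt_def]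
      · rw [Function.update_of_ne fun h => hci' (π.injective h), hf, cubeVertex_eq_iff, hflag,
          hflag']
        by_cases hci : c = k.castSucc
        · subst hci
          rw [Equiv.swap_apply_left, if_neg, if_neg] <;> simp [hj₀, hq]
        · rw [Equiv.swap_apply_of_ne_of_ne hci hci',
            hother c hci hci' j₀ q (by simp [hj₀]) (by simp [hq])]
    · rw [Function.update_of_ne hj, hf, cubeVertex_eq_iff, hflag, hflag']
      have hj' : (j : ℕ) ≠ k + 1 := fun h => hj (Fin.ext h)
      congr 1
      rw [eq_iff_iff]
      by_cases hci : c = k.castSucc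
      · subst hci
        rw [Equiv.swap_apply_left]
        simp only [Fin.lt_def, Fin.val_castSucc, Fin.val_succ]
        omega
      · by_cases hci' : c = k.succ
        · subst hci'
          rw [Equiv.swap_apply_right]
          simp only [Fin.lt_def, Fin.val_castSucc, Fin.val_succ]
          omega
        · rw [Equiv.swap_apply_of_ne_of_ne hci hci']
  refine Subtype.ext (Ideal.Quotient.eq.2 ?_)
  have hsub := Ideal.sub_mem _ hA hB
  rw [← mul_sub] at hsub
  have hswap : ({v | v i' = f j₀ i' ∧ v i = f j₀ i} : Finset (∀ i, V i)) =
      ({v | v i = f j₀ i ∧ v i' = f j₀ i'} : Finset (∀ i, V i)) :=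
    filter_congr fun v _ => and_comm
  rw [hswap, add_sub_add_right_eq_sub, mul_sub, ← prod_update, ← prod_update, hfq, hfq'] at hsub
  exact hsub

/-- Adjacent transpositions generate the symmetric group. -/
theorem simplexClass_flagSimplex_eq (e : Cube G) (π : Equiv.Perm (Fin d)) :
    simplexClass G (flagSimplex e π) = simplexClass G (flagSimplex e 1) := by
  cases d with
  | zero => rw [Subsingleton.elim π 1]
  | succ n =>
    have hπ : π ∈ Submonoid.closure
        (Set.range fun i : Fin n => Equiv.swap i.castSucc i.succ) := by
      rw [Equiv.Perm.mclosure_swap_castSucc_succ]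
      trivial
    induction hπ using Submonoid.closure_induction_right with
    | one => rfl
    | mul_right x hx y hy ih =>
      obtain ⟨k, rfl⟩ := hy
      rw [simplexClass_flagSimplex_mul_swap, ih]

end Flags

/-! ### The cube classes span the top degree. -/

section Generation

variable {d : ℕ} {V : Fin d → Type u} [∀ i, LinearOrder (V i)] [∀ i, Fintype (V i)]
  {G : ∀ i, SimpleGraph (V i)}

/-- For a vertex `f j` of a chain there is a relation expressing it, up to rational equivalence on
the chain, by smaller vertices of the chain and by vertices outside of the chain. -/
theorem exists_relation {ι : Type*} (s : Finset ι) (f : ι → ∀ i, V i)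
    (hf : ∀ j ∈ s, ∀ l ∈ s, f j ≤ f l ∨ f l ≤ f j) {j : ι} (hj : j ∈ s) :
    ∃ F : Finset (∀ i, V i), f j ∈ F ∧ (∀ l ∈ s, f l ∈ F → f l ≠ f j → f l < f j) ∧
      (∏ r ∈ s, X (f r)) * ∑ v ∈ F, X v ∈ ratIdeal G := by
  by_cases hmax : ∀ l ∈ s, ¬ f j < f l
  · refine ⟨univ, mem_univ _, fun l hl _ hne => ?_, prod_total_mem_ratIdeal s f hj⟩
    exact lt_of_le_of_ne ((hf l hl j hj).resolve_right fun h =>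
      hmax l hl (lt_of_le_of_ne h hne.symm)) hne
  · push Not at hmax
    obtain ⟨l₀, hl₀, hlt₀⟩ := hmax
    have hne : (s.filter fun l => f j < f l).Nonempty := ⟨l₀, by simp [hl₀, hlt₀]⟩
    -- `f r` is the next vertex of the chain and `i` a coordinate moved on the way to it. The slice
    -- through `f j` at `i` contains no vertex of the chain from `f r` on.
    obtain ⟨r, hr, hrmin⟩ := Finset.exists_minimalFor f _ hne
    obtain ⟨hrs, hjr⟩ : r ∈ s ∧ f j < f r := by simpa using hr
    obtain ⟨i, hi⟩ := (Pi.lt_def.1 hjr).2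
    refine ⟨_, ?_, fun l hl hlF hne => ?_, prod_slice_mem_ratIdeal (G := G) s f hj hrs hi.ne⟩
    · simp
    refine lt_of_le_of_ne ((hf l hl j hj).resolve_right fun h => ?_) hne
    have hjl : f j < f l := lt_of_le_of_ne h hne.symm
    have hrl : f r ≤ f l := by
      rcases hf r hrs l hl with h | h
      · exact h
      · exact hrmin (by simp [hl, hjl]) h
    have := hrl i
    rw [(mem_filter.1 hlF).2] at this
    exact absurd hi (not_lt.2 this)

/-- The class in the Chow ring of the maximal simplices of a cube. -/
noncomputable def cubeClass (e : Cube G) : Chow G :=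
  (simplexClass G (flagSimplex e 1) : Chow G)

theorem exists_simplexClass_eq_cubeClass (σ : NDSimplex G d) :
    ∃ e : Cube G, (simplexClass G σ : Chow G) = cubeClass e := by
  obtain ⟨e, π, rfl⟩ := exists_flagSimplex_eq σ
  exact ⟨e, by rw [simplexClass_flagSimplex_eq, cubeClass]⟩

theorem mk_prod_mem_span_of_injective {v : Fin (d + 1) → ∀ i, V i} (hv : Function.Injective v) :
    Ideal.Quotient.mk (ratIdeal G) (∏ j, X (v j)) ∈
      Submodule.span ℤ (Set.range (cubeClass (G := G))) := by
  by_cases hF : FormSimplex G v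
  · obtain ⟨π, hπ⟩ := hF
    obtain ⟨e, he⟩ := exists_simplexClass_eq_cubeClass
      ⟨v ∘ π, hπ, hπ.monotone.strictMono_of_injective (hv.comp π.injective)⟩
    have h : (∏ j, X (v j) : MvPolynomial (∀ i, V i) ℤ) = ∏ j, X ((v ∘ π) j) :=
      (Equiv.prod_comp π fun j => (X (v j) : MvPolynomial (∀ i, V i) ℤ)).symm
    rw [h]
    exact Submodule.subset_span ⟨e, he.symm⟩
  · rw [Ideal.Quotient.eq_zero_iff_mem.2 (prod_X_mem_ratIdeal hF)]
    exact zero_mem _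

/-- A repeated factor is traded, by `exists_relation`, for vertices outside the chain, which
increase the number of distinct vertices, or for lower vertices of the chain. The outer induction
handles the former, an inner one on the poset the latter. -/
theorem mk_prod_mem_span (v : Fin (d + 1) → ∀ i, V i) :
    Ideal.Quotient.mk (ratIdeal G) (∏ j, X (v j)) ∈
      Submodule.span ℤ (Set.range (cubeClass (G := G))) := by
  induction hn : d + 1 - #(univ.image v) using Nat.strong_induction_on generalizing v with
  | _ n ih =>
  subst hn
  by_cases hv : Function.Injective v
  · exact mk_prod_mem_span_of_injective hv
  by_cases hF : FormSimplex G v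
  swap
  · rw [Ideal.Quotient.eq_zero_iff_mem.2 (prod_X_mem_ratIdeal hF)]
    exact zero_mem _
  rw [Function.Injective] at hv
  push Not at hv
  obtain ⟨q, j₁, hq, hne⟩ := hv
  have hmem (j : Fin (d + 1)) : ∃ l ∈ univ.erase q, v l = v j := by
    by_cases hj : j = q
    · exact ⟨j₁, mem_erase.2 ⟨hne.symm, mem_univ _⟩, by rw [hj, hq]⟩
    · exact ⟨j, mem_erase.2 ⟨hj, mem_univ _⟩, rfl⟩
  have key (x : ∀ i, V i) (hx : ∃ j ∈ univ.erase q, v j = x) :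
      Ideal.Quotient.mk (ratIdeal G) ((∏ j ∈ univ.erase q, X (v j)) * X x) ∈
        Submodule.span ℤ (Set.range (cubeClass (G := G))) := by
    induction x using WellFoundedLT.induction with
    | _ x ihx =>
    obtain ⟨j, hj, rfl⟩ := hx
    obtain ⟨F, hjF, hlt, hrel⟩ := exists_relation (G := G) (univ.erase q) v
      (fun j _ l _ => hF.comparable j l) hj
    rw [← Ideal.Quotient.eq_zero_iff_mem, ← add_sum_erase _ _ hjF, mul_add, map_add,
      add_eq_zero_iff_eq_neg] at hrel
    rw [hrel, mul_sum, map_sum]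
    refine Submodule.neg_mem _ (Submodule.sum_mem _ fun y hy => ?_)
    obtain ⟨hyx, hyF⟩ := mem_erase.1 hy
    by_cases hyS : ∃ l ∈ univ.erase q, v l = y
    · obtain ⟨l, hl, rfl⟩ := hyS
      exact ihx _ (hlt l hl hyF hyx) ⟨l, hl, rfl⟩
    · rw [← prod_update]
      refine ih _ ?_ (Function.update v q y) rfl
      -- The vertex `v q` occurs elsewhere too, so overwriting position `q` loses nothing and gains
      -- `y`.
      have hsub : insert y (univ.image v) ⊆ univ.image (Function.update v q y) := by
        intro w hw
        rcases mem_insert.1 hw with rfl | hw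
        · exact mem_image.2 ⟨q, mem_univ _, Function.update_self ..⟩
        · obtain ⟨r, -, rfl⟩ := mem_image.1 hw
          obtain ⟨l, hl, hlr⟩ := hmem r
          exact mem_image.2 ⟨l, mem_univ _, by
            rw [Function.update_of_ne (ne_of_mem_erase hl), hlr]⟩
      have hy' : y ∉ univ.image v := by
        intro hy'
        obtain ⟨r, -, rfl⟩ := mem_image.1 hy'
        exact hyS (hmem r)
      have h1 := card_le_card hsub
      rw [card_insert_of_notMem hy'] at h1
      have h2 : #(univ.image (Function.update v q y)) ≤ d + 1 := by
        simpa using card_image_le (s := (univ : Finset (Fin (d + 1))))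
          (f := Function.update v q y)
      omega
  have h := key (v q) (hmem q)
  rwa [prod_erase_mul _ _ (mem_univ q)] at h

theorem exists_prod_X_eq_monomial {σ : Type*} {k : ℕ} (m : σ →₀ ℕ) (hm : m.degree = k) :
    ∃ v : Fin k → σ, (monomial m 1 : MvPolynomial σ ℤ) = ∏ j, X (v j) := by
  have hlen : (Finsupp.toMultiset m).toList.length = k := by
    rw [Multiset.length_toList, Finsupp.card_toMultiset, ← hm]
    rfl
  subst hlen
  refine ⟨fun j => (Finsupp.toMultiset m).toList[(j : ℕ)], ?_⟩
  rw [Fin.prod_univ_fun_getElem (Finsupp.toMultiset m).toList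
    (X : σ → MvPolynomial σ ℤ), ← Multiset.prod_coe, ← Multiset.map_coe, Multiset.coe_toList,
    Finsupp.toMultiset_map, Finsupp.prod_toMultiset, monomial_eq, C_1, one_mul,
    Finsupp.prod_mapDomain_index (fun _ => pow_zero _) (fun _ _ _ => pow_add _ _ _)]

theorem chowPiece_le_span :
    chowPiece G (d + 1) ≤ Submodule.span ℤ (Set.range (cubeClass (G := G))) := by
  rintro _ ⟨p, hp, rfl⟩
  change Ideal.Quotient.mk (ratIdeal G) p ∈ _
  rw [p.as_sum, map_sum]
  refine Submodule.sum_mem _ fun m hm => ?_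
  have hdeg : m.degree = d + 1 := by
    rw [Finsupp.degree_eq_weight_one]
    exact hp (mem_support_iff.1 hm)
  obtain ⟨v, hv⟩ := exists_prod_X_eq_monomial m hdeg
  have h : monomial m (coeff m p) = coeff m p • (monomial m 1 : MvPolynomial (∀ i, V i) ℤ) := by
    rw [smul_monomial, smul_eq_mul, mul_one]
  rw [h, hv, map_zsmul]
  exact Submodule.smul_mem _ _ (mk_prod_mem_span v)

end Generation

/-! ### The top degree of the hypercube. -/

section HypercubeCube

variable {d : ℕ}

/-- The unique cube of the hypercube. -/
def unitCube (d : ℕ) : Cube (hypercube d) := fun _ => ⟨s(0, 1), by simp⟩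

theorem cubeVertex_unitCube (z : Fin d → Fin 2) : cubeVertex (unitCube d) z = z := by
  funext i
  rw [cubeVertex_eq_of_lt (e := unitCube d) rfl Fin.zero_lt_one]
  split_ifs <;> omega

theorem cube_hypercube_eq (e : Cube (hypercube d)) : e = unitCube d := by
  funext i
  refine Subtype.ext ?_
  obtain ⟨s, hs⟩ := e i
  induction s with
  | _ a b =>
    have key : ∀ a b : Fin 2, a ≠ b → s(a, b) = s(0, 1) := by decide
    exact key a b hs

theorem simplexClass_hypercube_eq (σ : NDSimplex (hypercube d) d) :
    simplexClass (hypercube d) σ =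
      simplexClass (hypercube d) (flagSimplex (unitCube d) 1) := by
  obtain ⟨e, π, rfl⟩ := exists_flagSimplex_eq σ
  rw [simplexClass_flagSimplex_eq, cube_hypercube_eq e]

theorem exists_eq_smul_simplexClass (x : chowPiece (hypercube d) (d + 1)) :
    ∃ n : ℤ, x = n • simplexClass (hypercube d) (flagSimplex (unitCube d) 1) := by
  have hx := chowPiece_le_span x.2
  have hr : Set.range (cubeClass (G := hypercube d)) = {cubeClass (unitCube d)} := by
    ext y
    constructor
    · rintro ⟨e, rfl⟩
      rw [cube_hypercube_eq e]
      rfl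
    · rintro rfl
      exact ⟨_, rfl⟩
  rw [hr, Submodule.mem_span_singleton] at hx
  obtain ⟨n, hn⟩ := hx
  exact ⟨n, Subtype.ext hn.symm⟩

/-- The degree on the top graded piece of the Chow ring of the hypercube. -/
noncomputable def pieceDegree (d : ℕ) : chowPiece (hypercube d) (d + 1) →ₗ[ℤ] ℤ :=
  chowDegree d ∘ₗ (chowPiece (hypercube d) (d + 1)).subtype

theorem pieceDegree_simplexClass (σ : NDSimplex (hypercube d) d) :
    pieceDegree d (simplexClass (hypercube d) σ) = 1 :=
  chowDegree_simplexClass σ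

/-- The hypercube has a single cube, so its top piece is generated by one class, and that class has
degree 1. -/
theorem pieceDegree_bijective (d : ℕ) : Function.Bijective (pieceDegree d) := by
  constructor
  · rw [← LinearMap.ker_eq_bot, LinearMap.ker_eq_bot']
    intro x hx
    obtain ⟨n, rfl⟩ := exists_eq_smul_simplexClass x
    rw [map_smul, pieceDegree_simplexClass, smul_eq_mul, mul_one] at hx
    rw [hx, zero_smul]
  · intro n
    refine ⟨n • simplexClass (hypercube d) (flagSimplex (unitCube d) 1), ?_⟩
    rw [map_smul, pieceDegree_simplexClass, smul_eq_mul, mul_one]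

end HypercubeCube

/-! ### Restriction to cubes and the general product. -/

section Restrict

variable {d : ℕ} {V : Fin d → Type u} [∀ i, LinearOrder (V i)] [∀ i, Fintype (V i)]
  {G : ∀ i, SimpleGraph (V i)}

theorem flagVertex_zero (π : Equiv.Perm (Fin d)) : flagVertex π 0 = 0 := by
  funext i
  simp [flagVertex]

theorem flagVertex_last (π : Equiv.Perm (Fin d)) : flagVertex π (Fin.last d) = 1 := by
  funext i
  simp [flagVertex, Fin.castSucc_lt_last]

/-- A cube is determined by any cube containing its smallest and its largest vertex. -/
theorem cube_eq_of_vertices {e e' : Cube G} {z w : Fin d → Fin 2}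
    (hz : cubeVertex e' z = cubeVertex e 0) (hw : cubeVertex e' w = cubeVertex e 1) :
    e' = e := by
  have hbot (e : Cube G) (i : Fin d) : cubeVertex e 0 i = (e i).1.inf := by simp [cubeVertex]
  have htop (e : Cube G) (i : Fin d) : cubeVertex e 1 i = (e i).1.sup := by simp [cubeVertex]
  funext i
  have hlt : cubeVertex e' z i < cubeVertex e' w i := by
    rw [hz, hw, cubeVertex_lt_iff]
    exact Fin.zero_lt_one
  rw [cubeVertex_lt_iff] at hlt
  have hz0 : z i = (0 : Fin d → Fin 2) i := by
    change z i = 0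
    omega
  have hw1 : w i = (1 : Fin d → Fin 2) i := by
    change w i = 1
    omega
  have h0 := congrFun hz i
  have h1 := congrFun hw i
  rw [(cubeVertex_eq_iff e' _ _ i).2 hz0, hbot, hbot] at h0
  rw [(cubeVertex_eq_iff e' _ _ i).2 hw1, htop, htop] at h1
  exact Subtype.ext (Sym2.inf_eq_inf_and_sup_eq_sup.1 ⟨h0, h1⟩)

/-- A flag of `e` contains the lowest and highest vertices of `e`. If no factor is killed in `e'`,
both lie in `e'`, which forces `e' = e`. -/
theorem chowDegree_chowRestrict_cubeClass (e e' : Cube G) :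
    chowDegree d (chowRestrict e' (cubeClass e)) = if e' = e then 1 else 0 := by
  change chowDegree d (Ideal.Quotient.mk _
    (polyRestrict e' (∏ j, X (cubeVertex e (flagVertex 1 j))))) = _
  rw [map_prod]
  split_ifs with h
  · subst h
    rw [← chowDegree_simplexClass (flagSimplex (unitCube d) 1)]
    simp only [polyRestrict_X_cubeVertex, simplexClass, flagSimplex_apply, cubeVertex_unitCube]
  · have h0 : ∃ j, polyRestrict e' (X (cubeVertex e (flagVertex 1 j))) = 0 := by
      by_contra! hne
      have hex (j) : ∃ z, cubeVertex e' z = cubeVertex e (flagVertex 1 j) := by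
        by_contra! hz
        exact hne j (polyRestrict_X_of_forall_ne e' hz)
      obtain ⟨z, hz⟩ := hex 0
      obtain ⟨w, hw⟩ := hex (Fin.last d)
      rw [flagVertex_zero] at hz
      rw [flagVertex_last] at hw
      exact h (cube_eq_of_vertices hz hw)
    obtain ⟨j, hj⟩ := h0
    rw [prod_eq_zero (mem_univ j) hj, map_zero, map_zero]

/-- The degrees of the restrictions to all cubes. -/
noncomputable def cubeDegrees (G : ∀ i, SimpleGraph (V i)) :
    chowPiece G (d + 1) →ₗ[ℤ] (Cube G → ℤ) :=
  LinearMap.pi fun e => pieceDegree d ∘ₗ pieceRestrict e (d + 1)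

theorem cubeDegrees_flagSimplex (e e' : Cube G) :
    cubeDegrees G (simplexClass G (flagSimplex e 1)) e' = if e' = e then 1 else 0 :=
  chowDegree_chowRestrict_cubeClass e e'

theorem cubeDegrees_sum [Fintype (Cube G)] (n : Cube G → ℤ) :
    cubeDegrees G (∑ e, n e • simplexClass G (flagSimplex e 1)) = n := by
  funext e
  rw [map_sum, Finset.sum_apply]
  simp only [map_smul, Pi.smul_apply, cubeDegrees_flagSimplex, smul_eq_mul, mul_ite, mul_one,
    mul_zero, sum_ite_eq, mem_univ, if_true]

theorem exists_eq_sum_simplexClass [Fintype (Cube G)] (x : chowPiece G (d + 1)) :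
    ∃ n : Cube G → ℤ, x = ∑ e, n e • simplexClass G (flagSimplex e 1) := by
  obtain ⟨n, hn⟩ := (Submodule.mem_span_range_iff_exists_fun ℤ).1 (chowPiece_le_span x.2)
  refine ⟨n, Subtype.ext ?_⟩
  rw [← hn, AddSubmonoidClass.coe_finsetSum]
  rfl

/-- The spanning cube classes are sent to the standard basis, so they form a basis themselves. -/
theorem cubeDegrees_bijective (G : ∀ i, SimpleGraph (V i)) :
    Function.Bijective (cubeDegrees G) := by
  have := Fintype.ofFinite (Cube G)
  constructor
  · rw [← LinearMap.ker_eq_bot, LinearMap.ker_eq_bot']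
    intro x hx
    obtain ⟨n, rfl⟩ := exists_eq_sum_simplexClass x
    rw [cubeDegrees_sum] at hx
    simp [hx]
  · exact fun n => ⟨_, cubeDegrees_sum n⟩

theorem sum_cubeDegrees_simplexClass [Fintype (Cube G)] (σ : NDSimplex G d) :
    ∑ e, cubeDegrees G (simplexClass G σ) e = 1 := by
  obtain ⟨e, π, rfl⟩ := exists_flagSimplex_eq σ
  simp only [simplexClass_flagSimplex_eq, cubeDegrees_flagSimplex, sum_ite_eq', mem_univ, if_true]

end Restrict

end GraphProduct

theorem mainTheorem6 (d : ℕ) :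
    -- all non-degenerate `d`-simplex monomials of the hypercube are equal
    (∀ σ τ : GraphProduct.NDSimplex (GraphProduct.hypercube d) d,
      GraphProduct.simplexClass (GraphProduct.hypercube d) σ =
        GraphProduct.simplexClass (GraphProduct.hypercube d) τ) ∧
    -- the canonical isomorphism in degree `d + 1`
    ∃ deg : GraphProduct.chowPiece (GraphProduct.hypercube d) (d + 1) ≃ₗ[ℤ] ℤ,
      (∀ σ : GraphProduct.NDSimplex (GraphProduct.hypercube d) d,
        deg (GraphProduct.simplexClass (GraphProduct.hypercube d) σ) = 1) ∧
      (∀ deg' : GraphProduct.chowPiece (GraphProduct.hypercube d) (d + 1) ≃ₗ[ℤ] ℤ,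
        (∀ σ : GraphProduct.NDSimplex (GraphProduct.hypercube d) d,
          deg' (GraphProduct.simplexClass (GraphProduct.hypercube d) σ) = 1) → deg' = deg) ∧
      -- products of `d` finite simple connected graphs with totally ordered vertex sets
      ∀ (V : Fin d → Type*) [∀ i, LinearOrder (V i)] [∀ i, Fintype (V i)]
        (G : ∀ i, SimpleGraph (V i)) [∀ i, DecidableRel (G i).Adj],
        (∀ i, (G i).Connected) →
        (∃ Φ : GraphProduct.chowPiece G (d + 1) ≃ₗ[ℤ] (GraphProduct.Cube G → ℤ),
          ∀ (x : GraphProduct.chowPiece G (d + 1)) (e : GraphProduct.Cube G),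
            Φ x e = deg (GraphProduct.pieceRestrict e (d + 1) x)) ∧
        Module.Free ℤ (GraphProduct.chowPiece G (d + 1)) ∧
        Module.finrank ℤ (GraphProduct.chowPiece G (d + 1)) =
          ∏ i, Nat.card (G i).edgeSet ∧
        -- the degree map
        ∃ degG : GraphProduct.chowPiece G (d + 1) →ₗ[ℤ] ℤ,
          (∀ x : GraphProduct.chowPiece G (d + 1),
            degG x = ∑ e : GraphProduct.Cube G,
              deg (GraphProduct.pieceRestrict e (d + 1) x)) ∧
          ∀ σ : GraphProduct.NDSimplex G d, degG (GraphProduct.simplexClass G σ) = 1 := by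
  refine ⟨fun σ τ => ?_, LinearEquiv.ofBijective _ (GraphProduct.pieceDegree_bijective d),
    GraphProduct.pieceDegree_simplexClass, fun deg' hdeg' => ?_, ?_⟩
  · rw [GraphProduct.simplexClass_hypercube_eq σ, GraphProduct.simplexClass_hypercube_eq τ]
  · refine LinearEquiv.ext fun x => ?_
    obtain ⟨n, rfl⟩ := GraphProduct.exists_eq_smul_simplexClass x
    rw [map_smul, map_smul, hdeg', LinearEquiv.ofBijective_apply,
      GraphProduct.pieceDegree_simplexClass]
  · intro V _ _ G _ _
    let Φ := LinearEquiv.ofBijective _ (GraphProduct.cubeDegrees_bijective G)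
    refine ⟨⟨Φ, fun x e => rfl⟩, Module.Free.of_equiv Φ.symm, ?_,
      ∑ e : GraphProduct.Cube G, LinearMap.proj e ∘ₗ GraphProduct.cubeDegrees G,
      fun x => ?_, fun σ => ?_⟩
    · rw [Φ.finrank_eq, Module.finrank_fintype_fun_eq_card, ← Nat.card_eq_fintype_card,
        Nat.card_pi]
    · rw [LinearMap.sum_apply]
      rfl
    · rw [LinearMap.sum_apply]
      exact GraphProduct.sum_cubeDegrees_simplexClass σ
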